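/- **Theorem 1 (Optimal noise distribution, all-noise limit).** Let $\mu$ be a base measure ("$dx$") and let $p_{\beta}$, $\beta\in\mathbb R^k$ ($k\ge1$), be a well-specified parametric model with data density $p_d=p_{\beta^*}$. Noise-contrastive estimation with noise density $p_n$ and noise-data ratio $\nu>0$ uses the classifier $F(x;\beta)=\log p_\beta(x)-\log(\nu p_n(x))$; its parameter gradient $g(x):=\nabla_\beta F(x;\beta^*)=\nabla_\beta\log p_{\beta}(x)|_{\beta=\beta^*}$ is the (generalized) Fisher score and depends neither on $p_n$ nor on $\nu$. Assume that for $\beta$ near $\beta^*$ the function $p_\beta$ is nonnegative and integrable, that $g$ exists $p_d$-almost everywhere, and that the generalized Fisher information $I:=\mathbb E_{p_d}[gg^\top]$ is finite and invertible. Assume that the model is of one of the following two kinds. * *Normalized:* $\int p_\beta\,d\mu=1$ for $\beta$ near $\beta^*$, where $\beta\mapsto p_\beta(x)$ is differentiable at $\beta^*$ for $\mu$-almost every $x$ and $|p_\beta(x)-p_{\beta^*}(x)|\le B(x)\|\beta-\beta^*\|$ near $\beta^*$ for some integrable $B$ (so that one may differentiate under the integral sign). * *Unnormalized:* $\beta=(\theta,c)$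 and $p_\beta(x)=\tilde p(x;\theta)e^{-c}$ near $\beta^*$, with the log-normalization constant $c$ as a free parameter. For $w(x)=P(Y=0\mid x)=\dfrac{\nu p_n(x)}{p_d(x)+\nu p_n(x)}$ put $m_w=\mathbb E_{p_d}[w g]$ and $I_w=\mathbb E_{p_d}[w gg^\top]$. The asymptotic parametric mean-squared error of logistic NCE with total budget $T>0$ of data and noise points is $$\mathrm{MSE}(T,\nu,p_n)=\frac{\nu+1}{T}\,\mathrm{tr}\Big(I_w^{-1}-\frac{\nu+1}{\nu}\,I_w^{-1}m_wm_w^\top I_w^{-1}\Big).$$ Let $m=\mathbb E_{p_d}[g]$, $M=I^{-1}mm^\top I^{-1}$, $w_1(x)=\|g(x)\|_{I^{-2}}=\sqrt{g(x)^\top I^{-2}g(x)}$, $K=\big(\int p_d w_1\,d\mu\big)^2$, and let $p_d\bullet w_1=p_dw_1/\int p_dw_1\,d\mu$. For densities $p,q$ let $\mathcal D_{\chi^2}(p,q)=\int p^2/q\,d\mu-1\in[0,\infty]$ (with $0/0=0$, and $a/0=\infty$ for $a>0$). Call a noise density $p_n$ *admissible* if $p_n>0$ almost everywhere on $\{p_d>0,\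 g\ne0\}$; this holds in particular if $p_n>0$ wherever $p_d>0$. Set $$p_n^{\mathrm{opt}}:=p_d\bullet w_1 .$$ 1. $K>0$, and $p_n^{\mathrm{opt}}$ is an admissible probability density, equal to $p_d\,\|I^{-1}g\|\big/\int p_d\,\|I^{-1}g\|\,d\mu$. For every admissible $p_n$ and every $\nu>0$, the matrix $I_w$ is invertible. 2. *(All-noise limit.)* For every admissible $p_n$ with $\mathcal D_{\chi^2}(p_d\bullet w_1,p_n)<\infty$, as $\nu\to\infty$, $$\mathrm{MSE}(T,\nu,p_n)=\frac{\nu}{T}\,\mathrm{tr}(I^{-1}-M)+\frac1T\Big(\mathrm{tr}(I^{-1}-2M)+K\big(1+\mathcal D_{\chi^2}(p_d\bullet w_1,p_n)\big)\Big)+o(1).$$ If the divergence is infinite, then $\mathrm{MSE}(T,\nu,p_n)-\frac{\nu}{T}\mathrm{tr}(I^{-1}-M)\to+\infty$. So, at the two leading orders, the error depends on the noise only through $\mathcal D_{\chi^2}(p_d\bullet w_1,p_n)$. 3. *(Optimal noise.)* For every probability density $p_n$, $\mathcal D_{\chi^2}(p_d\bullet w_1,p_n)=0$ if and only if $p_n=p_n^{\mathrm{opt}}$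 almost everywhere. For every admissible $p_n$ that is not almost everywhere equal to $p_n^{\mathrm{opt}}$, $\mathrm{MSE}(T,\nu,p_n^{\mathrm{opt}})<\mathrm{MSE}(T,\nu,p_n)$ for all sufficiently large $\nu$. 4. *(Noise close to the data.)* For every fixed $\nu>0$ there are $C$ and $\delta_0>0$, which do not depend on the noise, such that for every noise density $p_n$ with $p_d/p_n=1+\epsilon$ and $|\epsilon|\le\delta\le\delta_0$ almost everywhere, the divergence $\mathcal D_{\chi^2}(p_d\bullet w_1,p_n)$ is finite and $$\Big|\mathrm{MSE}(T,\nu,p_n)-\frac{(1+\nu)^2}{T\nu}\mathrm{tr}(I^{-1}-M)-\frac{1+\nu}{T\nu}\Big(K\big(1+\mathcal D_{\chi^2}(p_d\bullet w_1,p_n)\big)-\mathrm{tr}(I^{-1})\Big)\Big|\le C\delta^2 .$$ So up to first order in the perturbation the error again depends on the noise only through the same divergence, and by 3 the first-order expression is minimized over all densities exactly by $p_n^{\mathrm{opt}}$. -/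

import Mathlib

open MeasureTheory Filter Topology Matrix

namespace NCE

noncomputable section

/-- A probability density with respect to the base measure `μ`. -/
structure IsDensity {X : Type*} [MeasurableSpace X] (μ : Measure X) (q : X → ℝ) : Prop where
  nonneg : ∀ x, 0 ≤ q x
  integrable : Integrable q μ
  integral_eq_one : ∫ x, q x ∂μ = 1

/-- The model classifier `F(x; β) = log p_β(x) - log (ν p_n(x))`. -/
def classifier {X ι : Type*} (p : EuclideanSpace ℝ ι → X → ℝ) (pn : X → ℝ) (ν : ℝ)
    (β : EuclideanSpace ℝ ι) (x : X) : ℝ :=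
  Real.log (p β x) - Real.log (ν * pn x)

/-- The (generalized) Fisher score at `β₀`, the gradient in `β` of `log p_β(x)`. -/
def score {X ι : Type*} [Fintype ι] (p : EuclideanSpace ℝ ι → X → ℝ)
    (β₀ : EuclideanSpace ℝ ι) (x : X) : EuclideanSpace ℝ ι :=
  gradient (fun β => Real.log (p β x)) β₀

/-- The score is the parameter gradient of the classifier, whatever the noise is. -/
theorem gradient_classifier {X ι : Type*} [Fintype ι] (p : EuclideanSpace ℝ ι → X → ℝ)
    (pn : X → ℝ) (ν : ℝ) (β₀ : EuclideanSpace ℝ ι) (x : X) :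
    gradient (fun β => classifier p pn ν β x) β₀ = score p β₀ x := by
  simp only [score, gradient, classifier, fderiv_sub_const]

/-- The posterior probability `P(Y = 0 | x)` that `x` is a noise point, when noise and data
points come in the ratio `ν`. -/
def noisePosterior {X : Type*} (pd pn : X → ℝ) (ν : ℝ) (x : X) : ℝ :=
  ν * pn x / (pd x + ν * pn x)

/-- The reweighted score mean `m_w = E_{x ∼ pd} [w(x) g(x)]`. -/
def scoreMean {X ι : Type*} [MeasurableSpace X] (μ : Measure X) (pd : X → ℝ)
    (g : X → EuclideanSpace ℝ ι) (w : X → ℝ) : ι → ℝ :=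
  fun i => ∫ x, w x * g x i * pd x ∂μ

/-- The reweighted score second-moment matrix `I_w = E_{x ∼ pd} [w(x) g(x) g(x)ᵀ]`. -/
def scoreCov {X ι : Type*} [MeasurableSpace X] (μ : Measure X) (pd : X → ℝ)
    (g : X → EuclideanSpace ℝ ι) (w : X → ℝ) : Matrix ι ι ℝ :=
  Matrix.of fun i j => ∫ x, w x * (g x i * g x j) * pd x ∂μ

/-- The generalized Fisher information `I = E_{x ∼ pd} [g(x) g(x)ᵀ]`. -/
def fisher {X ι : Type*} [MeasurableSpace X] (μ : Measure X) (pd : X → ℝ)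
    (g : X → EuclideanSpace ℝ ι) : Matrix ι ι ℝ :=
  scoreCov μ pd g (fun _ => 1)

/-- The asymptotic parametric mean-squared error of logistic NCE with total budget `T`,
noise-data ratio `ν` and noise density `pn`:
`(ν + 1) / T * tr (I_w⁻¹ - (ν + 1) / ν * I_w⁻¹ m_w m_wᵀ I_w⁻¹)` with `w(x) = P(Y = 0 | x)`. -/
def mse {X ι : Type*} [MeasurableSpace X] [Fintype ι] [DecidableEq ι] (μ : Measure X)
    (pd : X → ℝ) (g : X → EuclideanSpace ℝ ι) (T ν : ℝ) (pn : X → ℝ) : ℝ :=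
  let Iw := scoreCov μ pd g (noisePosterior pd pn ν)
  let mw := scoreMean μ pd g (noisePosterior pd pn ν)
  (ν + 1) / T *
    Matrix.trace (Iw⁻¹ - ((ν + 1) / ν) • (Iw⁻¹ * Matrix.vecMulVec mw mw * Iw⁻¹))

/-- The norm `‖v‖_A = √⟨v, A v⟩` induced by the metric `A`. -/
def metricNorm {ι : Type*} [Fintype ι] (A : Matrix ι ι ℝ) (v : EuclideanSpace ℝ ι) : ℝ :=
  Real.sqrt (v.ofLp ⬝ᵥ (A *ᵥ v.ofLp))

/-- The normalized product `f g / ∫ f g`. -/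
def normProd {X : Type*} [MeasurableSpace X] (μ : Measure X) (f g : X → ℝ) (x : X) : ℝ :=
  f x * g x / ∫ y, f y * g y ∂μ

/-- The chi-squared divergence `∫ p² / q - 1`, with values in `[0, ∞]`, of two densities.
In `ℝ≥0∞`, `0 / 0 = 0` and `a / 0 = ∞` for `a ≠ 0`, and for densities the integral is at
least `1`. -/
def chiSq {X : Type*} [MeasurableSpace X] (μ : Measure X) (p q : X → ℝ) : ENNReal :=
  (∫⁻ x, ENNReal.ofReal (p x) ^ 2 / ENNReal.ofReal (q x) ∂μ) - 1

/-- Standing assumptions on a well-specified parametric model `p` with true parameter `β₀`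
and data density `p β₀`: near `β₀` the model is nonnegative and integrable, `p β₀` is a
probability density, the score exists on the support of the data, and the Fisher information
is finite and invertible. -/
structure IsRegularModel {X ι : Type*} [MeasurableSpace X] [Fintype ι] [DecidableEq ι]
    (μ : Measure X) (p : EuclideanSpace ℝ ι → X → ℝ) (β₀ : EuclideanSpace ℝ ι) : Prop where
  nonneg : ∀ᶠ β in 𝓝 β₀, ∀ x, 0 ≤ p β x
  integrable : ∀ᶠ β in 𝓝 β₀, Integrable (p β) μ
  isDensity : IsDensity μ (p β₀)
  differentiableAt : ∀ᵐ x ∂μ, 0 < p β₀ x → DifferentiableAt ℝ (fun β => p β x) β₀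
  memLp_score : MemLp (score p β₀) 2 (μ.withDensity fun x => ENNReal.ofReal (p β₀ x))
  isUnit_det_fisher : IsUnit (fisher μ (p β₀) (score p β₀)).det

/-- A normalized model: `∫ p_β = 1` for all `β` near `β₀`, with the usual domination that
allows the differentiation of this identity under the integral sign at `β₀`. -/
structure IsNormalizedModel {X ι : Type*} [MeasurableSpace X] [Fintype ι]
    (μ : Measure X) (p : EuclideanSpace ℝ ι → X → ℝ) (β₀ : EuclideanSpace ℝ ι) : Prop where
  integral_eq_one : ∀ᶠ β in 𝓝 β₀, ∫ x, p β x ∂μ = 1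
  differentiableAt : ∀ᵐ x ∂μ, DifferentiableAt ℝ (fun β => p β x) β₀
  dominated : ∃ r > 0, ∃ B : X → ℝ, Integrable B μ ∧
    ∀ᵐ x ∂μ, ∀ β ∈ Metric.ball β₀ r, |p β x - p β₀ x| ≤ B x * ‖β - β₀‖

/-- An unnormalized model `p(x; (θ, c)) = q(x; θ) / exp c`: one coordinate `j` of
`β = (θ, c)` is the free log-normalization constant `c`, the other ones form `θ`. -/
def IsUnnormalizedModel {X ι : Type*} [Fintype ι]
    (p : EuclideanSpace ℝ ι → X → ℝ) (β₀ : EuclideanSpace ℝ ι) : Prop :=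
  ∃ (j : ι) (q : ({i : ι // i ≠ j} → ℝ) → X → ℝ),
    ∀ᶠ β in 𝓝 β₀, ∀ x, p β x = q (fun i => β i) x / Real.exp (β j)

end

end NCE

/-! Everything is computed under the probability `P = pd μ`, with score `G`, information `J = E[G
Gᵀ]`, whitened score `u = J⁻¹ G` and density ratio `t = pd / pn`. Where `pn > 0` the posterior
weight is `ν / (t + ν)`, which is written as `c (1 - ρ)` with `ρ` small: `c = 1`, `ρ = t / (t + ν)`
when `ν → ∞`, and `c = ν / (1 + ν)`, `ρ = (t - 1) / (t + ν)` when `t` is close to `1`. With `U = E[ρ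
u uᵀ]` the reweighted information is `c A`, `A = J - J U J`, and `inv_sub_conj` gives the exact
identity `A⁻¹ = J⁻¹ + U + U (J A⁻¹ J) U`. So the first-order part of the trace is `tr U = E[ρ
‖u‖²]`, and to leading order this is linear in `E[t ‖u‖²]`. Since `popt` is proportional to `pd
‖u‖`, that number is `K (1 + χ²)` (`one_add_chiSq_normProd`). The mean term does not interfere
(`exists_errorOfMoments_eq`). A normalized model has a centered score, so `I_w⁻¹ m_w = -A⁻¹ J E[ρ
u]`, whose square is of higher order. In an unnormalized model one coordinate of the score is `-1`,
and `I_w⁻¹ m_w` is a fixed basis vector up to sign, whatever the weight. As `ν → ∞`, `ν ρ` increases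
to `t`: dominated convergence gives the finite expansion, and monotone convergence the blow-up. Near
the data all neglected terms are bounded by constants times `δ²`. Optimality follows because `χ²`
vanishes only at equal densities. -/

namespace NCE

/-! ### Weighted first and second moments of a random vector -/

section Moments

variable {X ι : Type*} [MeasurableSpace X]

/-- The weighted second-moment matrix `E_P [w G Gᵀ]`. -/
noncomputable def secondMoment (P : Measure X) (G : X → ι → ℝ) (w : X → ℝ) : Matrix ι ι ℝ :=
  Matrix.of fun i j => ∫ x, w x * (G x i * G x j) ∂P

/-- The weighted first moment `E_P [w G]`. -/
noncomputable def firstMoment (P : Measure X) (G : X → ι → ℝ) (w : X → ℝ) : ι → ℝ :=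
  fun i => ∫ x, w x * G x i ∂P

variable {P : Measure X} {G : X → ι → ℝ}

theorem integrable_mul_coord_mul_coord (hG : ∀ i, MemLp (fun x => G x i) 2 P) {w : X → ℝ}
    {c : ℝ} (hw : AEStronglyMeasurable w P) (hc : ∀ᵐ x ∂P, |w x| ≤ c) (i j : ι) :
    Integrable (fun x => w x * (G x i * G x j)) P :=
  ((hG i).integrable_mul (hG j)).bdd_mul hw hc

theorem integrable_mul_coord [IsFiniteMeasure P] (hG : ∀ i, MemLp (fun x => G x i) 2 P)
    {w : X → ℝ} {c : ℝ} (hw : AEStronglyMeasurable w P) (hc : ∀ᵐ x ∂P, |w x| ≤ c) (i : ι) :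
    Integrable (fun x => w x * G x i) P :=
  ((hG i).integrable (by norm_num)).bdd_mul hw hc

/-- The weight is irrelevant where the score vanishes, which is why admissibility requires nothing
of the noise there. -/
theorem secondMoment_congr {w w' : X → ℝ} (h : ∀ᵐ x ∂P, G x = 0 ∨ w x = w' x) :
    secondMoment P G w = secondMoment P G w' := by
  ext i j
  refine integral_congr_ae ?_
  filter_upwards [h] with x hx
  rcases hx with hx | hx <;> simp [hx]

theorem firstMoment_congr {w w' : X → ℝ} (h : ∀ᵐ x ∂P, G x = 0 ∨ w x = w' x) :
    firstMoment P G w = firstMoment P G w' := by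
  ext i
  refine integral_congr_ae ?_
  filter_upwards [h] with x hx
  rcases hx with hx | hx <;> simp [hx]

theorem secondMoment_isSymm (w : X → ℝ) : (secondMoment P G w).IsSymm := by
  ext i j
  simp [secondMoment, mul_comm (G _ i)]

theorem secondMoment_mul_one_sub (hG : ∀ i, MemLp (fun x => G x i) 2 P) {ρ : X → ℝ}
    {b : ℝ} (hρ : AEStronglyMeasurable ρ P) (hb : ∀ᵐ x ∂P, |ρ x| ≤ b) (c : ℝ) :
    secondMoment P G (fun x => c * (1 - ρ x)) =
      c • (secondMoment P G (fun _ => 1) - secondMoment P G ρ) := by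
  ext i j
  simp only [secondMoment, of_apply, Matrix.smul_apply, Matrix.sub_apply, smul_eq_mul]
  rw [← integral_sub, ← integral_const_mul]
  · exact integral_congr_ae (.of_forall fun x => by ring)
  · exact ((hG i).integrable_mul (hG j)).const_mul 1
  · exact integrable_mul_coord_mul_coord hG hρ hb i j

theorem firstMoment_mul_one_sub [IsFiniteMeasure P] (hG : ∀ i, MemLp (fun x => G x i) 2 P)
    {ρ : X → ℝ} {b : ℝ} (hρ : AEStronglyMeasurable ρ P) (hb : ∀ᵐ x ∂P, |ρ x| ≤ b) (c : ℝ) :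
    firstMoment P G (fun x => c * (1 - ρ x)) =
      c • (firstMoment P G (fun _ => 1) - firstMoment P G ρ) := by
  ext i
  simp only [firstMoment, Pi.smul_apply, Pi.sub_apply, smul_eq_mul]
  rw [← integral_sub, ← integral_const_mul]
  · exact integral_congr_ae (.of_forall fun x => by ring)
  · simpa using (hG i).integrable (by norm_num)
  · exact integrable_mul_coord hG hρ hb i

variable [Fintype ι]

theorem dotProduct_secondMoment_mulVec {w : X → ℝ}
    (h : ∀ i j, Integrable (fun x => w x * (G x i * G x j)) P) (v : ι → ℝ) :
    v ⬝ᵥ (secondMoment P G w *ᵥ v) = ∫ x, w x * (v ⬝ᵥ G x) ^ 2 ∂P := by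
  have e : ∀ x, w x * (v ⬝ᵥ G x) ^ 2 = ∑ i, ∑ j, v i * v j * (w x * (G x i * G x j)) := by
    intro x
    rw [sq, dotProduct, Finset.sum_mul_sum, Finset.mul_sum]
    refine Finset.sum_congr rfl fun i _ => ?_
    rw [Finset.mul_sum]
    exact Finset.sum_congr rfl fun j _ => by ring
  simp_rw [e]
  rw [integral_finsetSum _ fun i _ => integrable_finsetSum _ fun j _ => (h i j).const_mul _]
  simp_rw [dotProduct, mulVec, dotProduct, Finset.mul_sum]
  refine Finset.sum_congr rfl fun i _ => ?_
  rw [integral_finsetSum _ fun j _ => (h i j).const_mul _]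
  refine Finset.sum_congr rfl fun j _ => ?_
  rw [integral_const_mul]
  simp only [secondMoment, of_apply]
  ring

theorem secondMoment_posSemidef {w : X → ℝ}
    (h : ∀ i j, Integrable (fun x => w x * (G x i * G x j)) P) (hw : ∀ᵐ x ∂P, 0 ≤ w x) :
    (secondMoment P G w).PosSemidef := by
  refine PosSemidef.of_dotProduct_mulVec_nonneg ?_ fun v => ?_
  · rw [IsHermitian, conjTranspose_eq_transpose_of_trivial]; exact secondMoment_isSymm w
  · rw [star_trivial, dotProduct_secondMoment_mulVec h]
    refine integral_nonneg_of_ae ?_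
    filter_upwards [hw] with x hx using mul_nonneg hx (sq_nonneg _)

/-- A kernel vector `v` satisfies `E[w (v ⬝ᵥ G)²] = 0`, so `v ⬝ᵥ G = 0` almost everywhere. Then `v`
is also in the kernel of the unweighted matrix, hence zero. -/
theorem isUnit_det_secondMoment [DecidableEq ι] (hG : ∀ i, MemLp (fun x => G x i) 2 P) {w : X → ℝ}
    (h : ∀ i j, Integrable (fun x => w x * (G x i * G x j)) P)
    (hw0 : ∀ᵐ x ∂P, 0 ≤ w x) (hw : ∀ᵐ x ∂P, G x = 0 ∨ 0 < w x)
    (hI : IsUnit (secondMoment P G (fun _ => 1)).det) :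
    IsUnit (secondMoment P G w).det := by
  have h1 : ∀ i j, Integrable (fun x => (1 : ℝ) * (G x i * G x j)) P := fun i j =>
    ((hG i).integrable_mul (hG j)).const_mul 1
  rw [← Matrix.isUnit_iff_isUnit_det, ← Matrix.mulVec_injective_iff_isUnit]
  rw [← Matrix.isUnit_iff_isUnit_det, ← Matrix.mulVec_injective_iff_isUnit] at hI
  refine (injective_iff_map_eq_zero (secondMoment P G w).mulVecLin).2 fun v hv => ?_
  replace hv : secondMoment P G w *ᵥ v = 0 := hv
  have h0 : ∫ x, w x * (v ⬝ᵥ G x) ^ 2 ∂P = 0 := by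
    rw [← dotProduct_secondMoment_mulVec h, hv, dotProduct_zero]
  have hint : Integrable (fun x => w x * (v ⬝ᵥ G x) ^ 2) P := by
    have e : (fun x => w x * (v ⬝ᵥ G x) ^ 2) =
        fun x => ∑ i, ∑ j, v i * v j * (w x * (G x i * G x j)) := by
      ext x
      rw [sq, dotProduct, Finset.sum_mul_sum, Finset.mul_sum]
      refine Finset.sum_congr rfl fun i _ => ?_
      rw [Finset.mul_sum]
      exact Finset.sum_congr rfl fun j _ => by ring
    rw [e]
    exact integrable_finsetSum _ fun i _ => integrable_finsetSum _ fun j _ => (h i j).const_mul _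
  rw [integral_eq_zero_iff_of_nonneg_ae (hw0.mono fun x hx => mul_nonneg hx (sq_nonneg _)) hint]
    at h0
  have hvG : ∀ᵐ x ∂P, v ⬝ᵥ G x = 0 := by
    filter_upwards [h0, hw] with x hx hx'
    rcases hx' with hx' | hx'
    · simp [hx']
    · simpa [hx'.ne'] using hx
  have h2 : secondMoment P G (fun _ => 1) *ᵥ v = 0 := by
    ext i
    have e : (secondMoment P G (fun _ => 1) *ᵥ v) i = ∫ x, G x i * (v ⬝ᵥ G x) ∂P := by
      simp_rw [mulVec, dotProduct, Finset.mul_sum]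
      rw [integral_finsetSum]
      · refine Finset.sum_congr rfl fun j _ => ?_
        simp only [secondMoment, of_apply]
        rw [← integral_mul_const]
        exact integral_congr_ae (.of_forall fun x => by ring)
      · intro j _
        refine ((h1 i j).const_mul (v j)).congr (.of_forall fun x => by ring)
    rw [e, integral_congr_ae (g := fun _ => 0) (hvG.mono fun x hx => by simp [hx])]
    simp
  exact hI (h2.trans (mulVec_zero _).symm)

theorem firstMoment_mulVec {w : X → ℝ} (h : ∀ i, Integrable (fun x => w x * G x i) P)
    (B : Matrix ι ι ℝ) :
    firstMoment P (fun x => B *ᵥ G x) w = B *ᵥ firstMoment P G w := by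
  ext i
  simp_rw [firstMoment, mulVec, dotProduct, Finset.mul_sum]
  rw [integral_finsetSum]
  · refine Finset.sum_congr rfl fun j _ => ?_
    simp only [firstMoment]
    rw [← integral_const_mul]
    exact integral_congr_ae (.of_forall fun x => by ring)
  · exact fun j _ => ((h j).const_mul (B i j)).congr (.of_forall fun x => by ring)

theorem secondMoment_mulVec {w : X → ℝ}
    (h : ∀ i j, Integrable (fun x => w x * (G x i * G x j)) P) (B : Matrix ι ι ℝ) :
    secondMoment P (fun x => B *ᵥ G x) w = B * secondMoment P G w * Bᵀ := by
  ext i j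
  simp_rw [mul_apply, transpose_apply, Finset.sum_mul]
  simp only [secondMoment, of_apply]
  have e : ∀ x, w x * ((B *ᵥ G x) i * (B *ᵥ G x) j) =
      ∑ b, ∑ a, B i a * B j b * (w x * (G x a * G x b)) := by
    intro x
    rw [mulVec, mulVec, dotProduct, dotProduct, Finset.sum_mul_sum, Finset.sum_comm,
      Finset.mul_sum]
    refine Finset.sum_congr rfl fun i _ => ?_
    rw [Finset.mul_sum]
    exact Finset.sum_congr rfl fun j _ => by ring
  simp_rw [e]
  rw [integral_finsetSum _ fun i _ => integrable_finsetSum _ fun j _ => (h _ _).const_mul _]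
  refine Finset.sum_congr rfl fun i _ => ?_
  rw [integral_finsetSum _ fun j _ => (h _ _).const_mul _]
  refine Finset.sum_congr rfl fun j _ => ?_
  rw [integral_const_mul]
  ring

theorem memLp_mulVec (hG : ∀ i, MemLp (fun x => G x i) 2 P) (B : Matrix ι ι ℝ) (i : ι) :
    MemLp (fun x => (B *ᵥ G x) i) 2 P :=
  memLp_finsetSum _ fun j _ => (hG j).const_mul (B i j)

end Moments

/-- The Cauchy-Schwarz inequality for a nonnegative weight. -/
theorem sq_integral_mul_le {X : Type*} [MeasurableSpace X] {P : Measure X} {ρ u : X → ℝ}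
    (hρ : ∀ᵐ x ∂P, 0 ≤ ρ x) (h0 : Integrable ρ P) (h1 : Integrable (fun x => ρ x * u x) P)
    (h2 : Integrable (fun x => ρ x * u x ^ 2) P) :
    (∫ x, ρ x * u x ∂P) ^ 2 ≤ (∫ x, ρ x * u x ^ 2 ∂P) * ∫ x, ρ x ∂P := by
  have h : ∀ s : ℝ, 0 ≤ (∫ x, ρ x ∂P) * (s * s) + (-2 * ∫ x, ρ x * u x ∂P) * s +
      ∫ x, ρ x * u x ^ 2 ∂P := by
    intro s
    have : ∫ x, ρ x * (u x - s) ^ 2 ∂P = (∫ x, ρ x ∂P) * (s * s) +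
        (-2 * ∫ x, ρ x * u x ∂P) * s + ∫ x, ρ x * u x ^ 2 ∂P := by
      rw [← integral_const_mul, ← integral_mul_const, ← integral_mul_const, ← integral_add,
        ← integral_add]
      · exact integral_congr_ae (.of_forall fun x => by ring)
      · exact (h0.mul_const _).add ((h1.const_mul _).mul_const _)
      · exact h2
      · exact h0.mul_const _
      · exact (h1.const_mul _).mul_const _
    rw [← this]
    exact integral_nonneg_of_ae (hρ.mono fun x hx => mul_nonneg hx (sq_nonneg _))
  have := discrim_le_zero h
  rw [discrim] at this
  nlinarith

/-! ### Resolvent expansion and the trace of the mean term -/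

section LinearAlgebra

variable {ι : Type*} [Fintype ι] [DecidableEq ι]

/-- The second-order expansion of the inverse of `J - J U J`. -/
theorem inv_sub_conj {J A U : Matrix ι ι ℝ} (hJ : IsUnit J.det) (hA : IsUnit A.det)
    (h : A = J - J * U * J) : A⁻¹ = J⁻¹ + U + U * (J * A⁻¹ * J) * U := by
  -- The left and right resolvent identities. Inserting the second into the first puts a `U` on each
  -- side of `A⁻¹`, so for symmetric `J`, `U` the remainder is positive semidefinite whenever `A`
  -- is.
  have h1 : A⁻¹ = J⁻¹ + U * J * A⁻¹ := by
    have : (J⁻¹ + U * J * A⁻¹) * A = 1 := by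
      rw [add_mul, Matrix.mul_assoc _ A⁻¹, nonsing_inv_mul _ hA, h, mul_sub, ← Matrix.mul_assoc,
        ← Matrix.mul_assoc, nonsing_inv_mul _ hJ]
      simp
    exact inv_eq_left_inv this
  have h2 : A⁻¹ = J⁻¹ + A⁻¹ * J * U := by
    have : A * (J⁻¹ + A⁻¹ * J * U) = 1 := by
      rw [mul_add, Matrix.mul_assoc A⁻¹, ← Matrix.mul_assoc A, mul_nonsing_inv _ hA, h, sub_mul,
        Matrix.mul_assoc _ J, mul_nonsing_inv _ hJ]
      simp
    exact inv_eq_right_inv this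
  calc A⁻¹ = J⁻¹ + U * J * A⁻¹ := h1
    _ = J⁻¹ + U * J * (J⁻¹ + A⁻¹ * J * U) := by rw [← h2]
    _ = _ := by
      rw [mul_add, Matrix.mul_assoc U, mul_nonsing_inv _ hJ]
      simp only [Matrix.mul_assoc, Matrix.mul_one, add_assoc]

theorem trace_inv_mul_vecMulVec_mul_inv {A : Matrix ι ι ℝ} (hA : A.IsSymm) (v : ι → ℝ) :
    (A⁻¹ * vecMulVec v v * A⁻¹).trace = (A⁻¹ *ᵥ v) ⬝ᵥ (A⁻¹ *ᵥ v) := by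
  have hA' : (A⁻¹)ᵀ = A⁻¹ := by rw [transpose_nonsing_inv, hA.eq]
  rw [mul_vecMulVec, vecMulVec_mul, trace_vecMulVec, ← mulVec_transpose, hA']

end LinearAlgebra

/-! ### Entrywise limits and elementary matrix bounds -/

section Matrices

variable {ι : Type*}

theorem tendsto_matrix {α : Type*} {l : Filter α} {A : α → Matrix ι ι ℝ} {B : Matrix ι ι ℝ}
    (h : ∀ i j, Tendsto (fun a => A a i j) l (𝓝 (B i j))) : Tendsto A l (𝓝 B) :=
  tendsto_pi_nhds.2 fun i => tendsto_pi_nhds.2 fun j => h i j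

theorem tendsto_apply {α : Type*} {l : Filter α} {A : α → Matrix ι ι ℝ} {B : Matrix ι ι ℝ}
    (h : Tendsto A l (𝓝 B)) (i j : ι) : Tendsto (fun a => A a i j) l (𝓝 (B i j)) :=
  tendsto_pi_nhds.1 (tendsto_pi_nhds.1 h i) j

variable [Fintype ι]

theorem tendsto_trace {α : Type*} {l : Filter α} {A : α → Matrix ι ι ℝ} {B : Matrix ι ι ℝ}
    (h : Tendsto A l (𝓝 B)) : Tendsto (fun a => (A a).trace) l (𝓝 B.trace) :=
  ((continuous_id.matrix_trace).tendsto B).comp h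

theorem dotProduct_mulVec_self_le (B : Matrix ι ι ℝ) (f : ι → ℝ) :
    (B *ᵥ f) ⬝ᵥ (B *ᵥ f) ≤ (∑ i, ∑ j, B i j ^ 2) * (f ⬝ᵥ f) := by
  rw [dotProduct, Finset.sum_mul]
  refine Finset.sum_le_sum fun i _ => ?_
  rw [← sq, mulVec, dotProduct, dotProduct]
  simp_rw [← sq]
  exact Finset.sum_mul_sq_le_sq_mul_sq _ _ _

/-- Lets integrability of the trace integrand dominate every matrix entry. -/
theorem abs_mul_le_dotProduct_self (v : ι → ℝ) (i j : ι) : |v i * v j| ≤ v ⬝ᵥ v := by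
  have h : ∀ k, v k ^ 2 ≤ v ⬝ᵥ v := fun k => by
    rw [dotProduct, sq]
    exact Finset.single_le_sum (f := fun k => v k * v k) (fun k _ => mul_self_nonneg _)
      (Finset.mem_univ k)
  have h1 := h i
  have h2 := h j
  rw [abs_le]
  constructor <;> nlinarith [sq_nonneg (v i - v j), sq_nonneg (v i + v j)]

theorem trace_secondMoment {X : Type*} [MeasurableSpace X] {P : Measure X} {G : X → ι → ℝ}
    (hG : ∀ i, MemLp (fun x => G x i) 2 P) {ρ : X → ℝ} {b : ℝ}
    (hρ : AEStronglyMeasurable ρ P) (hb : ∀ᵐ x ∂P, |ρ x| ≤ b) :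
    (secondMoment P G ρ).trace = ∫ x, ρ x * (G x ⬝ᵥ G x) ∂P := by
  simp_rw [trace, diag, dotProduct, Finset.mul_sum]
  rw [integral_finsetSum _ fun i _ => integrable_mul_coord_mul_coord hG hρ hb i i]
  rfl

end Matrices

/-! ### Exact expansion of the error in the perturbation of the weight -/

section Expansion

variable {X ι : Type*} [MeasurableSpace X] [Fintype ι] [DecidableEq ι]

/-- The error of logistic NCE in terms of the reweighted second and first score moments. -/
noncomputable def errorOfMoments (T ν : ℝ) (A : Matrix ι ι ℝ) (v : ι → ℝ) : ℝ :=
  (ν + 1) / T * Matrix.trace (A⁻¹ - ((ν + 1) / ν) • (A⁻¹ * Matrix.vecMulVec v v * A⁻¹))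

theorem errorOfMoments_eq (T ν : ℝ) {A : Matrix ι ι ℝ} (hA : A.IsSymm) (v : ι → ℝ) :
    errorOfMoments T ν A v =
      (ν + 1) / T * (A⁻¹.trace - (ν + 1) / ν * ((A⁻¹ *ᵥ v) ⬝ᵥ (A⁻¹ *ᵥ v))) := by
  rw [errorOfMoments, trace_sub, trace_smul, trace_inv_mul_vecMulVec_mul_inv hA, smul_eq_mul]

variable {P : Measure X} {G : X → ι → ℝ} {J : Matrix ι ι ℝ}

/-- Substitute `G = J u` with `u = J⁻¹ G`, and use the symmetry of `J`. -/
theorem secondMoment_eq_conj (hG : ∀ i, MemLp (fun x => G x i) 2 P)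
    (hJ : J = secondMoment P G fun _ => 1) (hu : IsUnit J.det) {ρ : X → ℝ} {b : ℝ}
    (hρ : AEStronglyMeasurable ρ P) (hb : ∀ᵐ x ∂P, |ρ x| ≤ b) :
    secondMoment P G ρ = J * secondMoment P (fun x => J⁻¹ *ᵥ G x) ρ * J := by
  have hs : (J⁻¹)ᵀ = J⁻¹ := by rw [transpose_nonsing_inv, hJ, (secondMoment_isSymm _).eq]
  rw [secondMoment_mulVec (integrable_mul_coord_mul_coord hG hρ hb), hs]
  rw [Matrix.mul_assoc, Matrix.mul_assoc, nonsing_inv_mul _ hu, Matrix.mul_one, ← Matrix.mul_assoc,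
    mul_nonsing_inv _ hu, Matrix.one_mul]

/-- Since `G j = -1`, the mean `E[w G] = -E[w G (G j)]` is minus the `j`-th column of the
second-moment matrix. The result does not depend on `w`. -/
theorem inv_mulVec_firstMoment {j : ι}
    (hj : ∀ᵐ x ∂P, G x j = -1) {w : X → ℝ} (hw : IsUnit (secondMoment P G w).det) :
    (secondMoment P G w)⁻¹ *ᵥ firstMoment P G w = - Pi.single j 1 := by
  have : firstMoment P G w = secondMoment P G w *ᵥ (- Pi.single j 1) := by
    ext i
    rw [mulVec_neg, mulVec_single_one, Pi.neg_apply]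
    simp only [firstMoment, secondMoment, col_apply, of_apply]
    rw [← integral_neg]
    refine integral_congr_ae (hj.mono fun x hx => ?_)
    simp [hx]
  rw [this, mulVec_mulVec, nonsing_inv_mul _ hw, one_mulVec]

/-- Here `e` is the excess of `‖I_w⁻¹ m_w‖²` over its value `tr M` at weight `1`. Its bound is
quadratic in the first moment of `ρ u`, so the mean contributes nothing at first order. -/
theorem exists_errorOfMoments_eq [IsFiniteMeasure P] (hG : ∀ i, MemLp (fun x => G x i) 2 P)
    (hJ : J = secondMoment P G fun _ => 1) (hu : IsUnit J.det)
    (hm : firstMoment P G (fun _ => 1) = 0 ∨ ∃ j, ∀ᵐ x ∂P, G x j = -1)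
    {ρ : X → ℝ} {b : ℝ} (hρ : AEStronglyMeasurable ρ P) (hb : ∀ᵐ x ∂P, |ρ x| ≤ b)
    {U : Matrix ι ι ℝ} (hU : U = secondMoment P (fun x => J⁻¹ *ᵥ G x) ρ)
    (hA : IsUnit (J - J * U * J).det) (T ν : ℝ) {c : ℝ} (hc : c ≠ 0) :
    ∃ e, 0 ≤ e ∧
      e ≤ (((J - J * U * J)⁻¹ * J) *ᵥ firstMoment P (fun x => J⁻¹ *ᵥ G x) ρ) ⬝ᵥ
        (((J - J * U * J)⁻¹ * J) *ᵥ firstMoment P (fun x => J⁻¹ *ᵥ G x) ρ) ∧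
      errorOfMoments T ν (secondMoment P G fun x => c * (1 - ρ x))
        (firstMoment P G fun x => c * (1 - ρ x)) =
      (ν + 1) / T * (c⁻¹ * (J⁻¹.trace + U.trace +
        (U * (J * (J - J * U * J)⁻¹ * J) * U).trace) - (ν + 1) / ν *
          ((J⁻¹ * vecMulVec (firstMoment P G fun _ => 1) (firstMoment P G fun _ => 1) * J⁻¹).trace
            + e)) := by
  have hW : (secondMoment P G fun x => c * (1 - ρ x)) = c • (J - J * U * J) := by
    rw [secondMoment_mul_one_sub hG hρ hb, hU, ← secondMoment_eq_conj hG hJ hu hρ hb, hJ]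
  have hWi : (c • (J - J * U * J))⁻¹ = c⁻¹ • (J - J * U * J)⁻¹ :=
    inv_smul' _ (Units.mk0 c hc) hA
  have hWu : IsUnit (secondMoment P G fun x => c * (1 - ρ x)).det := by
    rw [hW, det_smul]
    exact ((isUnit_iff_ne_zero.2 hc).pow _).mul hA
  have hJs : J.IsSymm := hJ ▸ secondMoment_isSymm _
  have hr : firstMoment P G ρ = J *ᵥ firstMoment P (fun x => J⁻¹ *ᵥ G x) ρ := by
    rw [firstMoment_mulVec (integrable_mul_coord hG hρ hb), mulVec_mulVec,
      mul_nonsing_inv _ hu, one_mulVec]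
  rw [errorOfMoments_eq _ _ (secondMoment_isSymm _), trace_inv_mul_vecMulVec_mul_inv hJs]
  have ht : ((secondMoment P G fun x => c * (1 - ρ x))⁻¹).trace = c⁻¹ * (J⁻¹.trace + U.trace +
        (U * (J * (J - J * U * J)⁻¹ * J) * U).trace) := by
    rw [hW, hWi, trace_smul, smul_eq_mul, ← trace_add, ← trace_add, ← inv_sub_conj hu hA rfl]
  rw [ht]
  rcases hm with hm | ⟨j, hj⟩
  -- Centered score: `tr M = 0`, so `e` is the whole squared norm. The factor `c` cancels between
  -- `I_w⁻¹` and `m_w`.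
  · refine ⟨_, ?_, le_rfl, ?_⟩
    · exact Finset.sum_nonneg fun i _ => mul_self_nonneg _
    · congr 3
      rw [firstMoment_mul_one_sub hG hρ hb, hm, hW, hWi, hr]
      simp [hc, smul_mulVec, mulVec_smul, mulVec_neg, smul_smul]
  -- Constant coordinate: both vectors are `-Pi.single j 1`, so the excess is zero.
  · refine ⟨0, le_rfl, Finset.sum_nonneg fun i _ => mul_self_nonneg _, ?_⟩
    have hu' : IsUnit (secondMoment P G fun _ => 1).det := hJ ▸ hu
    rw [inv_mulVec_firstMoment hj hWu, hJ, inv_mulVec_firstMoment hj hu', add_zero]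

/-- Adjugate over determinant is continuous where the determinant is nonzero, so only the limit has
to be invertible. -/
theorem tendsto_inv {α : Type*} {l : Filter α} {A : α → Matrix ι ι ℝ} {B : Matrix ι ι ℝ}
    (hB : IsUnit B.det) (h : Tendsto A l (𝓝 B)) : Tendsto (fun a => (A a)⁻¹) l (𝓝 B⁻¹) := by
  simp_rw [inv_def, Ring.inverse_eq_inv']
  have h1 : Tendsto (fun a => (A a).det) l (𝓝 B.det) :=
    ((continuous_id.matrix_det).tendsto B).comp h
  have h2 : Tendsto (fun a => (A a).adjugate) l (𝓝 B.adjugate) :=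
    ((continuous_id.matrix_adjugate).tendsto B).comp h
  exact (h1.inv₀ hB.ne_zero).smul h2

end Expansion

/-! ### The all-noise limit `ν → ∞` -/

section AllNoise

variable {X ι : Type*} [MeasurableSpace X]
variable {P : Measure X} {G : X → ι → ℝ} {t : X → ℝ}

theorem abs_div_add_le_one {a ν : ℝ} (ha : 0 ≤ a) (hν : 0 < ν) : |a / (a + ν)| ≤ 1 := by
  rw [abs_of_nonneg (by positivity), div_le_one (by positivity)]
  linarith

theorem mul_div_add_le {a ν : ℝ} (ha : 0 ≤ a) (hν : 0 < ν) : ν * (a / (a + ν)) ≤ a := by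
  rw [mul_div_assoc', div_le_iff₀ (by positivity)]
  nlinarith

theorem tendsto_div_add_atTop (a : ℝ) : Tendsto (fun ν : ℝ => a / (a + ν)) atTop (𝓝 0) :=
  tendsto_const_nhds.div_atTop (tendsto_atTop_add_const_left _ _ tendsto_id)

theorem tendsto_mul_div_add_atTop (a : ℝ) :
    Tendsto (fun ν : ℝ => ν * (a / (a + ν))) atTop (𝓝 a) := by
  have h := (tendsto_const_nhds (x := a)).sub ((tendsto_div_add_atTop a).const_mul a)
  rw [mul_zero, sub_zero] at h
  refine h.congr' ?_
  filter_upwards [eventually_gt_atTop (-a)] with ν hν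
  have : a + ν ≠ 0 := by linarith
  field_simp
  ring

theorem aestronglyMeasurable_div_add (ht : AEStronglyMeasurable t P) (ν : ℝ) :
    AEStronglyMeasurable (fun x => t x / (t x + ν)) P :=
  (ht.aemeasurable.div (ht.aemeasurable.add_const ν)).aestronglyMeasurable

/-- The weight is at most `1`, so no integrability of `t` is needed and the limit also serves the
case of infinite divergence. -/
theorem tendsto_secondMoment_zero (hG : ∀ i, MemLp (fun x => G x i) 2 P)
    (ht : AEStronglyMeasurable t P) (ht0 : ∀ᵐ x ∂P, 0 ≤ t x) :
    Tendsto (fun ν : ℝ => secondMoment P G fun x => t x / (t x + ν)) atTop (𝓝 0) := by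
  refine tendsto_matrix fun i j => ?_
  have : (0 : Matrix ι ι ℝ) i j = ∫ x, 0 * (G x i * G x j) ∂P := by simp
  rw [this]
  refine tendsto_integral_filter_of_dominated_convergence (fun x => |G x i * G x j|) ?_ ?_ ?_ ?_
  · exact .of_forall fun ν => (aestronglyMeasurable_div_add ht ν).mul
      ((hG i).aestronglyMeasurable.mul (hG j).aestronglyMeasurable)
  · filter_upwards [eventually_gt_atTop 0] with ν hν
    filter_upwards [ht0] with x hx
    rw [norm_mul, Real.norm_eq_abs, Real.norm_eq_abs]
    exact mul_le_of_le_one_left (abs_nonneg _) (abs_div_add_le_one hx hν)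
  · exact ((hG i).integrable_mul (hG j)).abs
  · exact .of_forall fun x => (tendsto_div_add_atTop _).mul_const _

theorem tendsto_integral_div_add [IsFiniteMeasure P]
    (ht : AEStronglyMeasurable t P) (ht0 : ∀ᵐ x ∂P, 0 ≤ t x) :
    Tendsto (fun ν : ℝ => ∫ x, t x / (t x + ν) ∂P) atTop (𝓝 0) := by
  have : (0 : ℝ) = ∫ x, 0 ∂P := by simp
  rw [this]
  refine tendsto_integral_filter_of_dominated_convergence (fun _ => 1) ?_ ?_ ?_ ?_
  · exact .of_forall fun ν => aestronglyMeasurable_div_add ht ν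
  · filter_upwards [eventually_gt_atTop 0] with ν hν
    filter_upwards [ht0] with x hx using abs_div_add_le_one hx hν
  · exact integrable_const _
  · exact .of_forall fun x => tendsto_div_add_atTop _

variable [Fintype ι]

theorem tendsto_smul_secondMoment (hG : ∀ i, MemLp (fun x => G x i) 2 P)
    (ht : AEStronglyMeasurable t P) (ht0 : ∀ᵐ x ∂P, 0 ≤ t x)
    (hi : Integrable (fun x => t x * (G x ⬝ᵥ G x)) P) :
    Tendsto (fun ν : ℝ => ν • secondMoment P G fun x => t x / (t x + ν)) atTop
      (𝓝 (secondMoment P G t)) := by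
  refine tendsto_matrix fun i j => ?_
  have e : ∀ ν : ℝ, (ν • secondMoment P G fun x => t x / (t x + ν)) i j =
      ∫ x, ν * (t x / (t x + ν)) * (G x i * G x j) ∂P := fun ν => by
    rw [Matrix.smul_apply, smul_eq_mul, secondMoment, of_apply, ← integral_const_mul]
    simp_rw [mul_assoc]
  simp_rw [e]
  refine tendsto_integral_filter_of_dominated_convergence (fun x => t x * (G x ⬝ᵥ G x)) ?_ ?_ hi ?_
  · exact .of_forall fun ν => ((aestronglyMeasurable_div_add ht ν).const_mul ν).mul
      ((hG i).aestronglyMeasurable.mul (hG j).aestronglyMeasurable)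
  · filter_upwards [eventually_gt_atTop 0] with ν hν
    filter_upwards [ht0] with x hx
    rw [norm_mul, Real.norm_eq_abs, Real.norm_eq_abs, abs_of_nonneg (a := ν * _) (by positivity)]
    exact mul_le_mul (mul_div_add_le hx hν) (abs_mul_le_dotProduct_self _ _ _) (abs_nonneg _) hx
  · exact .of_forall fun x => (tendsto_mul_div_add_atTop _).mul_const _

theorem tendsto_mul_trace_secondMoment (hG : ∀ i, MemLp (fun x => G x i) 2 P)
    (ht : AEStronglyMeasurable t P) (ht0 : ∀ᵐ x ∂P, 0 ≤ t x)
    (hi : Integrable (fun x => t x * (G x ⬝ᵥ G x)) P) :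
    Tendsto (fun ν : ℝ => ν * (secondMoment P G fun x => t x / (t x + ν)).trace) atTop
      (𝓝 (∫ x, t x * (G x ⬝ᵥ G x) ∂P)) := by
  have h := tendsto_trace (tendsto_smul_secondMoment hG ht ht0 hi)
  have e : (secondMoment P G t).trace = ∫ x, t x * (G x ⬝ᵥ G x) ∂P := by
    simp_rw [trace, diag, dotProduct, Finset.mul_sum]
    rw [integral_finsetSum]
    · rfl
    · intro i _
      refine hi.mono (ht.mul ((hG i).aestronglyMeasurable.mul (hG i).aestronglyMeasurable)) ?_
      filter_upwards [ht0] with x hx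
      rw [norm_mul, norm_mul (t x), Real.norm_eq_abs (_ * _), Real.norm_eq_abs (_ ⬝ᵥ _)]
      exact mul_le_mul_of_nonneg_left
        ((abs_mul_le_dotProduct_self (G x) i i).trans (le_abs_self (G x ⬝ᵥ G x)))
        (abs_nonneg (t x))
  rw [e] at h
  refine h.congr fun ν => ?_
  rw [trace_smul, smul_eq_mul]

/-- The integrand `ν t / (t + ν) * (G x ⬝ᵥ G x)` increases with `ν` to a function of infinite
integral, so monotone convergence applies. -/
theorem tendsto_mul_trace_secondMoment_atTop (hG : ∀ i, MemLp (fun x => G x i) 2 P)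
    (ht : AEStronglyMeasurable t P) (ht0 : ∀ᵐ x ∂P, 0 ≤ t x)
    (hi : ¬ Integrable (fun x => t x * (G x ⬝ᵥ G x)) P) :
    Tendsto (fun ν : ℝ => ν * (secondMoment P G fun x => t x / (t x + ν)).trace) atTop atTop := by
  have hGm : AEStronglyMeasurable (fun x => G x ⬝ᵥ G x) P :=
    Finset.aestronglyMeasurable_fun_sum _ fun i _ =>
      (hG i).aestronglyMeasurable.mul (hG i).aestronglyMeasurable
  have hG0 : ∀ x, 0 ≤ G x ⬝ᵥ G x := fun x => Finset.sum_nonneg fun i _ => mul_self_nonneg _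
  have hGi : Integrable (fun x => G x ⬝ᵥ G x) P :=
    integrable_finsetSum _ fun i _ => (hG i).integrable_mul (hG i)
  have hmono : ∀ x, 0 ≤ t x → ∀ a b : ℝ, 0 < a → a ≤ b →
      a * (t x / (t x + a)) ≤ b * (t x / (t x + b)) := fun x hx a b ha hab => by
    have hb := ha.trans_le hab
    rw [mul_div_assoc', mul_div_assoc', div_le_div_iff₀ (by positivity) (by positivity)]
    nlinarith [mul_nonneg (mul_nonneg hx hx) (sub_nonneg.2 hab)]
  have hint : ∀ ν : ℝ, 0 < ν →
      Integrable (fun x => ν * (t x / (t x + ν)) * (G x ⬝ᵥ G x)) P := fun ν hν => by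
    refine hGi.bdd_mul (c := ν) ((aestronglyMeasurable_div_add ht ν).const_mul ν) ?_
    filter_upwards [ht0] with x hx
    rw [norm_mul, Real.norm_of_nonneg hν.le]
    exact mul_le_of_le_one_right hν.le (abs_div_add_le_one hx hν)
  have e : ∀ ν : ℝ, 0 < ν → ν * (secondMoment P G fun x => t x / (t x + ν)).trace =
      ∫ x, ν * (t x / (t x + ν)) * (G x ⬝ᵥ G x) ∂P := fun ν hν => by
    rw [trace_secondMoment hG (aestronglyMeasurable_div_add ht ν)
      (ht0.mono fun x hx => abs_div_add_le_one hx hν), ← integral_const_mul]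
    simp_rw [mul_assoc]
  -- Monotone convergence is applied along `ν = n + 1`, which is always positive. Monotonicity in
  -- `ν` then extends the divergence to real `ν`.
  have hlim : Tendsto (fun n : ℕ => ∫⁻ x, ENNReal.ofReal
      (((n : ℝ) + 1) * (t x / (t x + ((n : ℝ) + 1))) * (G x ⬝ᵥ G x)) ∂P) atTop
      (𝓝 (∫⁻ x, ENNReal.ofReal (t x * (G x ⬝ᵥ G x)) ∂P)) := by
    refine lintegral_tendsto_of_tendsto_of_monotone ?_ ?_ ?_
    · exact fun n => (((aestronglyMeasurable_div_add ht _).const_mul _).mul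
        hGm).aemeasurable.ennreal_ofReal
    · filter_upwards [ht0] with x hx a b hab
      refine ENNReal.ofReal_le_ofReal (mul_le_mul_of_nonneg_right ?_ (hG0 x))
      exact hmono x hx _ _ (by positivity) (by gcongr)
    · refine .of_forall fun x => (ENNReal.continuous_ofReal.tendsto _).comp (Tendsto.mul_const _ ?_)
      exact (tendsto_mul_div_add_atTop (t x)).comp
        (tendsto_atTop_add_const_right _ _ tendsto_natCast_atTop_atTop)
  have htop : ∫⁻ x, ENNReal.ofReal (t x * (G x ⬝ᵥ G x)) ∂P = ⊤ := by
    by_contra h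
    refine hi ((lintegral_ofReal_ne_top_iff_integrable (ht.mul hGm) ?_).1 h)
    filter_upwards [ht0] with x hx using mul_nonneg hx (hG0 x)
  rw [htop] at hlim
  refine tendsto_atTop.2 fun C => ?_
  obtain ⟨n, hn⟩ := (hlim.eventually (lt_mem_nhds (ENNReal.ofReal_lt_top (r := C)))).exists
  have hn0 : (0 : ℝ) < n + 1 := by positivity
  filter_upwards [eventually_ge_atTop ((n : ℝ) + 1)] with ν hν
  have hν0 := hn0.trans_le hν
  rw [e ν hν0]
  rw [← ofReal_integral_eq_lintegral_ofReal (hint _ hn0) (by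
    filter_upwards [ht0] with x hx using mul_nonneg (by positivity) (hG0 x))] at hn
  refine (ENNReal.lt_ofReal_iff_toReal_lt ENNReal.ofReal_ne_top).1 hn |>.le.trans' ?_ |>.trans ?_
  · exact (le_max_left _ _).trans (ENNReal.toReal_ofReal' ..).ge
  · refine integral_mono_ae (hint _ hn0) (hint _ hν0) ?_
    filter_upwards [ht0] with x hx
    exact mul_le_mul_of_nonneg_right (hmono x hx _ _ hn0 hν) (hG0 x)

/-- Cauchy-Schwarz with weight `ρ` in each coordinate. The factor `E[ρ] → 0` makes the mean residual
negligible against `tr U`, even when `ν tr U` is unbounded. -/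
theorem dotProduct_firstMoment_self_le [IsFiniteMeasure P]
    (hG : ∀ i, MemLp (fun x => G x i) 2 P) {ρ : X → ℝ} {b : ℝ}
    (hρ : AEStronglyMeasurable ρ P) (hb : ∀ᵐ x ∂P, |ρ x| ≤ b) (h0 : ∀ᵐ x ∂P, 0 ≤ ρ x) :
    firstMoment P G ρ ⬝ᵥ firstMoment P G ρ ≤ (secondMoment P G ρ).trace * ∫ x, ρ x ∂P := by
  rw [dotProduct, trace, Finset.sum_mul]
  refine Finset.sum_le_sum fun i _ => ?_
  have hi := integrable_mul_coord_mul_coord hG hρ hb i i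
  have := sq_integral_mul_le (u := fun x => G x i) h0 (Integrable.of_bound hρ b hb)
    (integrable_mul_coord hG hρ hb i) (hi.congr (.of_forall fun x => by ring))
  rw [← sq]
  refine this.trans_eq ?_
  simp [secondMoment, sq]

variable [DecidableEq ι] [IsProbabilityMeasure P] {J : Matrix ι ι ℝ}

/-- The expansion with `c = 1` and `ρ = t / (t + ν)`, exact for each `ν`. The signs and the bound on
`e` by `tr U` require no integrability of `t ‖u‖²`, so finite and infinite divergence share it. -/
theorem exists_errorOfMoments_allNoise_eq (hG : ∀ i, MemLp (fun x => G x i) 2 P)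
    (hJ : J = secondMoment P G fun _ => 1) (hu : IsUnit J.det)
    (hm : firstMoment P G (fun _ => 1) = 0 ∨ ∃ j, ∀ᵐ x ∂P, G x j = -1)
    (ht : AEStronglyMeasurable t P) (ht0 : ∀ᵐ x ∂P, 0 ≤ t x) (T : ℝ) {ν : ℝ} (hν : 0 < ν)
    {U : Matrix ι ι ℝ} (hU : U = secondMoment P (fun x => J⁻¹ *ᵥ G x) fun x => t x / (t x + ν)) :
    0 ≤ U.trace ∧ 0 ≤ (U * (J * (J - J * U * J)⁻¹ * J) * U).trace ∧ ∃ e, 0 ≤ e ∧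
      e ≤ (∑ i, ∑ j, ((J - J * U * J)⁻¹ * J) i j ^ 2) *
        (U.trace * ∫ x, t x / (t x + ν) ∂P) ∧
      errorOfMoments T ν (secondMoment P G fun x => ν / (t x + ν))
        (firstMoment P G fun x => ν / (t x + ν)) - ν / T * (J⁻¹.trace -
          (J⁻¹ * vecMulVec (firstMoment P G fun _ => 1) (firstMoment P G fun _ => 1) *
            J⁻¹).trace) =
      1 / T * (J⁻¹.trace + (ν + 1) / ν * (ν * U.trace) +
        (ν + 1) / ν * (ν * (U * (J * (J - J * U * J)⁻¹ * J) * U).trace) - (2 + 1 / ν) *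
          (J⁻¹ * vecMulVec (firstMoment P G fun _ => 1) (firstMoment P G fun _ => 1) * J⁻¹).trace
        - ((ν + 1) / ν) ^ 2 * (ν * e)) := by
  have hρ := aestronglyMeasurable_div_add ht ν
  have hb : ∀ᵐ x ∂P, |t x / (t x + ν)| ≤ 1 := ht0.mono fun x hx => abs_div_add_le_one hx hν
  have h0 : ∀ᵐ x ∂P, 0 ≤ t x / (t x + ν) := ht0.mono fun x hx => by positivity
  have hGu := memLp_mulVec hG J⁻¹
  have hw : ∀ᵐ x ∂P, ν / (t x + ν) = 1 * (1 - t x / (t x + ν)) := by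
    filter_upwards [ht0] with x hx
    have : t x + ν ≠ 0 := by positivity
    field_simp
    ring
  have hA : (secondMoment P G fun x => ν / (t x + ν)) = J - J * U * J := by
    rw [secondMoment_congr (hw.mono fun _ => Or.inr), secondMoment_mul_one_sub hG hρ hb, hU,
      ← secondMoment_eq_conj hG hJ hu hρ hb, hJ, one_smul]
  have hwi := integrable_mul_coord_mul_coord (c := 1) (w := fun x => ν / (t x + ν)) hG
    (((aestronglyMeasurable_const.sub hρ).const_mul 1).congr (hw.mono fun _ h => h.symm)) (by
      filter_upwards [ht0] with x hx
      rw [abs_of_nonneg (by positivity), div_le_one (by positivity)]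
      linarith)
  have hAu : IsUnit (J - J * U * J).det := by
    rw [← hA]
    refine isUnit_det_secondMoment hG hwi ?_ ?_ (hJ ▸ hu)
    · filter_upwards [ht0] with x hx
      positivity
    · filter_upwards [ht0] with x hx
      right; positivity
  have hAp : (J - J * U * J).PosSemidef := by
    rw [← hA]
    exact secondMoment_posSemidef hwi (ht0.mono fun x hx => by positivity)
  have hUs : U.PosSemidef :=
    hU ▸ secondMoment_posSemidef (integrable_mul_coord_mul_coord hGu hρ hb) h0
  have hJs : Jᴴ = J := by
    rw [conjTranspose_eq_transpose_of_trivial, hJ, (secondMoment_isSymm _).eq]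
  obtain ⟨e, he0, he, heq⟩ := exists_errorOfMoments_eq hG hJ hu hm hρ hb hU hAu T ν one_ne_zero
  refine ⟨hUs.trace_nonneg, ?_, e, he0, ?_, ?_⟩
  · have h1 := hAp.inv.conjTranspose_mul_mul_same J
    rw [hJs] at h1
    have h2 := h1.conjTranspose_mul_mul_same U
    rw [hUs.1.eq] at h2
    exact h2.trace_nonneg
  · refine he.trans ((dotProduct_mulVec_self_le _ _).trans ?_)
    refine mul_le_mul_of_nonneg_left ?_ (Finset.sum_nonneg fun i _ => Finset.sum_nonneg fun j _ =>
      sq_nonneg _)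
    rw [hU]
    exact dotProduct_firstMoment_self_le hGu hρ hb h0
  · rw [secondMoment_congr (hw.mono fun _ => Or.inr), firstMoment_congr (hw.mono fun _ => Or.inr),
      heq]
    rcases eq_or_ne T 0 with rfl | hT
    · simp
    field_simp
    ring

/-- The two facts behind the all-noise limit: the residual due to the score mean is negligible
with respect to the trace term, and the inverse of the reweighted information converges. -/
theorem tendsto_allNoise_aux (hG : ∀ i, MemLp (fun x => G x i) 2 P)
    (hu : IsUnit J.det) (ht : AEStronglyMeasurable t P) (ht0 : ∀ᵐ x ∂P, 0 ≤ t x)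
    {U : ℝ → Matrix ι ι ℝ}
    (hU : ∀ ν, U ν = secondMoment P (fun x => J⁻¹ *ᵥ G x) fun x => t x / (t x + ν)) :
    Tendsto U atTop (𝓝 0) ∧
    Tendsto (fun ν => (J - J * U ν * J)⁻¹) atTop (𝓝 J⁻¹) ∧
    Tendsto (fun ν => (∑ i, ∑ j, ((J - J * U ν * J)⁻¹ * J) i j ^ 2) *
      ∫ x, t x / (t x + ν) ∂P) atTop (𝓝 0) := by
  have h1 : Tendsto U atTop (𝓝 0) := by
    rw [funext hU]
    exact tendsto_secondMoment_zero (memLp_mulVec hG J⁻¹) ht ht0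
  have h2 : Tendsto (fun ν => (J - J * U ν * J)⁻¹) atTop (𝓝 J⁻¹) := by
    refine tendsto_inv hu ?_
    simpa using (tendsto_const_nhds (x := J)).sub
      (((tendsto_const_nhds (x := J)).mul h1).mul (tendsto_const_nhds (x := J)))
  refine ⟨h1, h2, ?_⟩
  have h3 : Tendsto (fun ν => ∑ i, ∑ j, ((J - J * U ν * J)⁻¹ * J) i j ^ 2) atTop
      (𝓝 (∑ i, ∑ j, (J⁻¹ * J) i j ^ 2)) :=
    tendsto_finsetSum _ fun i _ => tendsto_finsetSum _ fun j _ =>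
      (tendsto_apply (h2.mul (tendsto_const_nhds (x := J))) i j).pow 2
  simpa using h3.mul (tendsto_integral_div_add ht ht0)

theorem tendsto_add_one_div : Tendsto (fun ν : ℝ => (ν + 1) / ν) atTop (𝓝 1) := by
  have h : Tendsto (fun ν : ℝ => 1 + 1 / ν) atTop (𝓝 (1 + 0)) :=
    tendsto_const_nhds.add (tendsto_const_nhds.div_atTop tendsto_id)
  rw [add_zero] at h
  refine h.congr' ?_
  filter_upwards [eventually_gt_atTop 0] with ν hν
  field_simp

theorem tendsto_errorOfMoments_allNoise (hG : ∀ i, MemLp (fun x => G x i) 2 P)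
    (hJ : J = secondMoment P G fun _ => 1) (hu : IsUnit J.det)
    (hm : firstMoment P G (fun _ => 1) = 0 ∨ ∃ j, ∀ᵐ x ∂P, G x j = -1)
    (ht : AEStronglyMeasurable t P) (ht0 : ∀ᵐ x ∂P, 0 ≤ t x)
    (hi : Integrable (fun x => t x * ((J⁻¹ *ᵥ G x) ⬝ᵥ (J⁻¹ *ᵥ G x))) P) (T : ℝ)
    {M : Matrix ι ι ℝ} (hM : M =
      J⁻¹ * vecMulVec (firstMoment P G fun _ => 1) (firstMoment P G fun _ => 1) * J⁻¹) :
    Tendsto (fun ν => errorOfMoments T ν (secondMoment P G fun x => ν / (t x + ν))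
        (firstMoment P G fun x => ν / (t x + ν)) - ν / T * (J⁻¹.trace - M.trace)) atTop
      (𝓝 (1 / T * (J⁻¹.trace - 2 * M.trace +
        ∫ x, t x * ((J⁻¹ *ᵥ G x) ⬝ᵥ (J⁻¹ *ᵥ G x)) ∂P))) := by
  set U : ℝ → Matrix ι ι ℝ := fun ν =>
    secondMoment P (fun x => J⁻¹ *ᵥ G x) fun x => t x / (t x + ν) with hU
  have hex := fun ν (hν : 0 < ν) =>
    exists_errorOfMoments_allNoise_eq hG hJ hu hm ht ht0 T hν (congrFun hU ν)
  choose! hU0 hR0 e he0 he heq using hex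
  obtain ⟨l1, l2, l3⟩ := tendsto_allNoise_aux hG hu ht ht0 (congrFun hU)
  have hGu := memLp_mulVec hG J⁻¹
  have la := tendsto_mul_trace_secondMoment hGu ht ht0 hi
  -- The factor `ν` is absorbed by one `U`, which makes it converge; the other `U` tends to zero.
  have lr : Tendsto (fun ν => ν * (U ν * (J * (J - J * U ν * J)⁻¹ * J) * U ν).trace) atTop
      (𝓝 0) := by
    have h := tendsto_trace ((((tendsto_smul_secondMoment hGu ht ht0 hi)).mul
      (((tendsto_const_nhds (x := J)).mul l2).mul (tendsto_const_nhds (x := J)))).mul l1)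
    rw [mul_zero, trace_zero] at h
    refine h.congr fun ν => ?_
    rw [smul_mul_assoc, smul_mul_assoc, trace_smul, smul_eq_mul]
  have le : Tendsto (fun ν => ν * e ν) atTop (𝓝 0) := by
    have h := l3.mul la
    rw [zero_mul] at h
    refine tendsto_of_tendsto_of_tendsto_of_le_of_le' tendsto_const_nhds h ?_ ?_
    · filter_upwards [eventually_gt_atTop 0] with ν hν using mul_nonneg hν.le (he0 ν hν)
    · filter_upwards [eventually_gt_atTop 0] with ν hν
      refine (mul_le_mul_of_nonneg_left (he ν hν) hν.le).trans_eq ?_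
      simp only [hU]
      ring
  have l0 : Tendsto (fun ν : ℝ => 2 + 1 / ν) atTop (𝓝 (2 + 0)) :=
    tendsto_const_nhds.add (tendsto_const_nhds.div_atTop tendsto_id)
  have l := ((((tendsto_const_nhds (x := J⁻¹.trace)).add (tendsto_add_one_div.mul la)).add
    (tendsto_add_one_div.mul lr)).sub (l0.mul_const M.trace)).sub
    ((tendsto_add_one_div.pow 2).mul le) |>.const_mul (1 / T)
  have hval : 1 / T * (J⁻¹.trace - 2 * M.trace +
        ∫ x, t x * ((J⁻¹ *ᵥ G x) ⬝ᵥ (J⁻¹ *ᵥ G x)) ∂P) =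
      1 / T * (J⁻¹.trace + 1 * ∫ x, t x * ((J⁻¹ *ᵥ G x) ⬝ᵥ (J⁻¹ *ᵥ G x)) ∂P + 1 * 0 -
        (2 + 0) * M.trace - 1 ^ 2 * 0) := by ring
  rw [hval]
  refine l.congr' ?_
  filter_upwards [eventually_gt_atTop 0] with ν hν
  rw [hM]
  exact (heq ν hν).symm

/-- The second-order trace is nonnegative and can be dropped, and the mean residual is `o(1)` times
`ν tr U`. What remains is `ν tr U → ∞` with a coefficient tending to `1`. -/
theorem tendsto_errorOfMoments_allNoise_atTop (hG : ∀ i, MemLp (fun x => G x i) 2 P)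
    (hJ : J = secondMoment P G fun _ => 1) (hu : IsUnit J.det)
    (hm : firstMoment P G (fun _ => 1) = 0 ∨ ∃ j, ∀ᵐ x ∂P, G x j = -1)
    (ht : AEStronglyMeasurable t P) (ht0 : ∀ᵐ x ∂P, 0 ≤ t x)
    (hi : ¬ Integrable (fun x => t x * ((J⁻¹ *ᵥ G x) ⬝ᵥ (J⁻¹ *ᵥ G x))) P) {T : ℝ} (hT : 0 < T)
    {M : Matrix ι ι ℝ} (hM : M =
      J⁻¹ * vecMulVec (firstMoment P G fun _ => 1) (firstMoment P G fun _ => 1) * J⁻¹) :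
    Tendsto (fun ν => errorOfMoments T ν (secondMoment P G fun x => ν / (t x + ν))
        (firstMoment P G fun x => ν / (t x + ν)) - ν / T * (J⁻¹.trace - M.trace)) atTop
      atTop := by
  set U : ℝ → Matrix ι ι ℝ := fun ν =>
    secondMoment P (fun x => J⁻¹ *ᵥ G x) fun x => t x / (t x + ν) with hU
  have hex := fun ν (hν : 0 < ν) =>
    exists_errorOfMoments_allNoise_eq hG hJ hu hm ht ht0 T hν (congrFun hU ν)
  choose! hU0 hR0 e he0 he heq using hex
  obtain ⟨l1, l2, l3⟩ := tendsto_allNoise_aux hG hu ht ht0 (congrFun hU)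
  have la := tendsto_mul_trace_secondMoment_atTop (memLp_mulVec hG J⁻¹) ht ht0 hi
  have l0 : Tendsto (fun ν : ℝ => 2 + 1 / ν) atTop (𝓝 (2 + 0)) :=
    tendsto_const_nhds.add (tendsto_const_nhds.div_atTop tendsto_id)
  have lk := (tendsto_add_one_div).sub ((tendsto_add_one_div.pow 2).mul l3)
  have l := ((((tendsto_const_nhds (x := J⁻¹.trace)).sub (l0.mul_const M.trace)).add_atTop
    (lk.pos_mul_atTop (by norm_num) la))).const_mul_atTop (one_div_pos.2 hT)
  refine tendsto_atTop_mono' _ ?_ l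
  filter_upwards [eventually_gt_atTop 0] with ν hν
  rw [hM, heq ν hν]
  refine mul_le_mul_of_nonneg_left ?_ (one_div_pos.2 hT).le
  have h1 : 0 ≤ (ν + 1) / ν * (ν * (U ν * (J * (J - J * U ν * J)⁻¹ * J) * U ν).trace) :=
    mul_nonneg (by positivity) (mul_nonneg hν.le (hR0 ν hν))
  have h2 : ((ν + 1) / ν) ^ 2 * (ν * e ν) ≤ ((ν + 1) / ν) ^ 2 *
      (ν * ((∑ i, ∑ j, ((J - J * U ν * J)⁻¹ * J) i j ^ 2) *
        ((U ν).trace * ∫ x, t x / (t x + ν) ∂P))) := by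
    gcongr
    exact he ν hν
  linear_combination h1 + h2

end AllNoise

/-! ### Noise close to the data: bounds uniform in the noise -/

section NearData

variable {X ι : Type*} [MeasurableSpace X] [Fintype ι]

theorem abs_mul_apply_le {A B : Matrix ι ι ℝ} {a b : ℝ} (ha : 0 ≤ a) (hA : ∀ i j, |A i j| ≤ a)
    (hB : ∀ i j, |B i j| ≤ b) (i j : ι) : |(A * B) i j| ≤ Fintype.card ι * (a * b) := by
  rw [mul_apply]
  refine (Finset.abs_sum_le_sum_abs _ _).trans ((Finset.sum_le_card_nsmul _ _ (a * b) ?_).trans_eq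
    (by simp))
  intro k _
  rw [abs_mul]
  exact mul_le_mul (hA i k) (hB k j) (abs_nonneg _) ha

theorem abs_trace_le {A : Matrix ι ι ℝ} {a : ℝ} (hA : ∀ i j, |A i j| ≤ a) :
    |A.trace| ≤ Fintype.card ι * a :=
  (Finset.abs_sum_le_sum_abs _ _).trans ((Finset.sum_le_card_nsmul _ _ a fun i _ => hA i i).trans_eq
    (by simp))

theorem dotProduct_self_le {f : ι → ℝ} {a : ℝ} (hf : ∀ i, |f i| ≤ a) :
    f ⬝ᵥ f ≤ Fintype.card ι * a ^ 2 := by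
  refine (Finset.sum_le_card_nsmul _ _ (a ^ 2) fun i _ => ?_).trans_eq (by simp)
  rw [← sq, ← sq_abs]
  gcongr
  exact hf i

/-- The bound is explicit and quadratic in `a`, the size of `U`, so the final constant can be chosen
before the noise. -/
theorem abs_trace_mul_conj_mul_le {U J B : Matrix ι ι ℝ} {a c κ : ℝ} (ha : 0 ≤ a) (hc : 0 ≤ c)
    (hκ : 0 ≤ κ) (hU : ∀ i j, |U i j| ≤ a) (hJ : ∀ i j, |J i j| ≤ c) (hB : ∀ i j, |B i j| ≤ κ) :
    |(U * (J * B * J) * U).trace| ≤ Fintype.card ι * (Fintype.card ι *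
      (Fintype.card ι * (a * (Fintype.card ι * (Fintype.card ι * (c * κ) * c))) * a)) := by
  have b1 := abs_mul_apply_le hc hJ hB
  have b2 := abs_mul_apply_le (by positivity) b1 hJ
  have b3 := abs_mul_apply_le ha hU b2
  exact abs_trace_le (abs_mul_apply_le (by positivity) b3 hU)

theorem dotProduct_mul_mulVec_self_le {J B : Matrix ι ι ℝ} {f : ι → ℝ} {a c κ : ℝ}
    (hκ : 0 ≤ κ) (hB : ∀ i j, |B i j| ≤ κ) (hJ : ∀ i j, |J i j| ≤ c) (hf : ∀ i, |f i| ≤ a) :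
    ((B * J) *ᵥ f) ⬝ᵥ ((B * J) *ᵥ f) ≤
      Fintype.card ι * (Fintype.card ι * (Fintype.card ι * (κ * c)) ^ 2) *
        (Fintype.card ι * a ^ 2) := by
  refine (dotProduct_mulVec_self_le _ _).trans ?_
  have b1 := abs_mul_apply_le hκ hB hJ
  refine mul_le_mul ?_ (dotProduct_self_le hf) (Finset.sum_nonneg fun i _ => mul_self_nonneg _)
    (by positivity)
  refine (Finset.sum_le_card_nsmul _ _ _ fun i _ => ?_).trans_eq (nsmul_eq_mul _ _)
  refine (Finset.sum_le_card_nsmul _ _ _ fun j _ => ?_).trans_eq (nsmul_eq_mul _ _)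
  rw [← sq_abs]
  exact pow_le_pow_left₀ (abs_nonneg _) (b1 i j) 2

variable {P : Measure X} {G : X → ι → ℝ}

theorem abs_secondMoment_apply_le (hG : ∀ i, MemLp (fun x => G x i) 2 P) {ρ : X → ℝ} {b : ℝ}
    (hρ : AEStronglyMeasurable ρ P) (hb : ∀ᵐ x ∂P, |ρ x| ≤ b) (i j : ι) :
    |secondMoment P G ρ i j| ≤ b * ∫ x, G x ⬝ᵥ G x ∂P := by
  rw [← integral_const_mul]
  have hi : Integrable (fun x => G x ⬝ᵥ G x) P :=
    integrable_finsetSum _ fun i _ => (hG i).integrable_mul (hG i)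
  refine (abs_integral_le_integral_abs).trans (integral_mono_ae
    (integrable_mul_coord_mul_coord hG hρ hb i j).abs (hi.const_mul b) ?_)
  filter_upwards [hb] with x hx
  rw [abs_mul]
  exact mul_le_mul hx (abs_mul_le_dotProduct_self _ _ _) (abs_nonneg _) ((abs_nonneg _).trans hx)

theorem abs_firstMoment_apply_le [IsFiniteMeasure P] (hG : ∀ i, MemLp (fun x => G x i) 2 P)
    {ρ : X → ℝ} {b : ℝ} (hρ : AEStronglyMeasurable ρ P) (hb : ∀ᵐ x ∂P, |ρ x| ≤ b) (i : ι) :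
    |firstMoment P G ρ i| ≤ b * ∫ x, ∑ k, |G x k| ∂P := by
  rw [← integral_const_mul]
  have hi : ∀ k, Integrable (fun x => G x k) P := fun k => (hG k).integrable (by norm_num)
  refine (abs_integral_le_integral_abs).trans (integral_mono_ae
    (integrable_mul_coord hG hρ hb i).abs
    ((integrable_finsetSum _ fun k _ => (hi k).abs).const_mul b) ?_)
  filter_upwards [hb] with x hx
  rw [abs_mul]
  exact mul_le_mul hx (Finset.single_le_sum (f := fun k => |G x k|) (fun k _ => abs_nonneg _)
    (Finset.mem_univ i)) (abs_nonneg _) ((abs_nonneg _).trans hx)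

variable [DecidableEq ι]

/-- The inverse of `J - J U J` is bounded for small `U`. -/
theorem exists_forall_abs_inv_sub_conj_le {J : Matrix ι ι ℝ} (hu : IsUnit J.det) :
    ∃ η > 0, ∃ κ, 0 ≤ κ ∧ ∀ U : Matrix ι ι ℝ, (∀ i j, |U i j| < η) →
      ∀ i j, |(J - J * U * J)⁻¹ i j| ≤ κ := by
  -- Matrices are read as functions of two indices, whose sup distance matches the entrywise bound
  -- by `η`.
  have hc : Continuous fun V : ι → ι → ℝ => J - J * Matrix.of V * J := by
    have : Continuous fun V : ι → ι → ℝ => (Matrix.of V : Matrix ι ι ℝ) := continuous_id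
    fun_prop
  have h1 : Tendsto (fun V : ι → ι → ℝ => J - J * Matrix.of V * J) (𝓝 0) (𝓝 J) := by
    have h0 : J - J * Matrix.of (0 : ι → ι → ℝ) * J = J := by
      rw [Matrix.of_zero]; simp
    simpa only [h0] using hc.tendsto 0
  have h2 := tendsto_inv hu h1
  have h3 : ∀ᶠ V : ι → ι → ℝ in 𝓝 0, ∀ i j,
      |(J - J * Matrix.of V * J)⁻¹ i j| < ∑ a, ∑ b, |J⁻¹ a b| + 1 := by
    refine eventually_all.2 fun i => eventually_all.2 fun j => ?_
    refine (tendsto_apply h2 i j).abs.eventually (gt_mem_nhds (lt_add_of_le_of_pos ?_ one_pos))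
    refine (Finset.single_le_sum (f := fun b => |J⁻¹ i b|) (fun _ _ => abs_nonneg _)
      (Finset.mem_univ j)).trans ?_
    exact Finset.single_le_sum (f := fun a => ∑ b, |J⁻¹ a b|)
      (fun _ _ => Finset.sum_nonneg fun _ _ => abs_nonneg _) (Finset.mem_univ i)
  obtain ⟨η, hη, h⟩ := Metric.eventually_nhds_iff.1 h3
  refine ⟨η, hη, _, by positivity, fun U hU i j => (h (y := U) ?_ i j).le⟩
  refine (dist_pi_lt_iff hη).2 fun i => (dist_pi_lt_iff hη).2 fun j => ?_
  simpa using hU i j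

variable [IsProbabilityMeasure P] {J : Matrix ι ι ℝ}

/-- Expand at `t = 1` with `c = ν / (1 + ν)` and `ρ = (t - 1) / (t + ν)`. Only `tr U` has a linear
part, `E[(t - 1) ‖u‖²] / (1 + ν)`; the other terms are quadratic in `ρ = O(δ)`. -/
theorem exists_abs_errorOfMoments_sub_le (hG : ∀ i, MemLp (fun x => G x i) 2 P)
    (hJ : J = secondMoment P G fun _ => 1) (hu : IsUnit J.det)
    (hm : firstMoment P G (fun _ => 1) = 0 ∨ ∃ j, ∀ᵐ x ∂P, G x j = -1)
    {M : Matrix ι ι ℝ} (hM : M =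
      J⁻¹ * vecMulVec (firstMoment P G fun _ => 1) (firstMoment P G fun _ => 1) * J⁻¹)
    {T ν : ℝ} (hT : 0 < T) (hν : 0 < ν) :
    ∃ C : ℝ, ∃ δ₀ > 0, δ₀ ≤ 1 / 2 ∧ ∀ (t : X → ℝ) (δ : ℝ), δ ≤ δ₀ → AEStronglyMeasurable t P →
      (∀ᵐ x ∂P, |t x - 1| ≤ δ) →
      |errorOfMoments T ν (secondMoment P G fun x => ν / (t x + ν))
          (firstMoment P G fun x => ν / (t x + ν)) -
        ((1 + ν) ^ 2 / (T * ν) * (J⁻¹.trace - M.trace) + (1 + ν) / (T * ν) *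
          (∫ x, t x * ((J⁻¹ *ᵥ G x) ⬝ᵥ (J⁻¹ *ᵥ G x)) ∂P - J⁻¹.trace))| ≤ C * δ ^ 2 := by
  have hGu := memLp_mulVec hG J⁻¹
  set u : X → ι → ℝ := fun x => J⁻¹ *ᵥ G x with hudef
  set s : ℝ := ∫ x, u x ⬝ᵥ u x ∂P with hs
  set s' : ℝ := ∫ x, ∑ k, |u x k| ∂P with hs'
  have hs0 : 0 ≤ s := integral_nonneg fun x => Finset.sum_nonneg fun i _ => mul_self_nonneg _
  have hs0' : 0 ≤ s' := integral_nonneg fun x => Finset.sum_nonneg fun i _ => abs_nonneg _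
  obtain ⟨η, hη, κ, hκ, hbd⟩ := exists_forall_abs_inv_sub_conj_le hu
  set n : ℝ := (Fintype.card ι : ℝ) with hn
  obtain ⟨c, hc0, hc⟩ : ∃ c, 0 ≤ c ∧ ∀ i j, |J i j| ≤ c := by
    refine ⟨∑ a, ∑ b, |J a b|, by positivity, fun i j => ?_⟩
    refine (Finset.single_le_sum (f := fun b => |J i b|) (fun _ _ => abs_nonneg _)
      (Finset.mem_univ j)).trans ?_
    exact Finset.single_le_sum (f := fun a => ∑ b, |J a b|)
      (fun _ _ => Finset.sum_nonneg fun _ _ => abs_nonneg _) (Finset.mem_univ i)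
  set k₂ := n * (κ * c) with hk₂
  set k₁ := n * (n * (c * κ) * c) with hk₁
  have hn0 : 0 ≤ n := by positivity
  clear_value s s' n
  have hk₂0 : 0 ≤ k₂ := by positivity
  have hk₁0 : 0 ≤ k₁ := by positivity
  clear_value k₁ k₂
  -- The three summands of `C` bound the linearization of `tr U`, the second-order trace and the
  -- mean residual `e`. In `δ₀`, the bound `1 / 2` keeps `t ≥ 1 / 2`, and `η / (4 * s + 1)` ensures
  -- `2 * δ * s < η`.
  refine ⟨(1 + ν) ^ 2 / (T * ν) * (2 * s + n * (n * (n * (2 * s * k₁) * (2 * s))) +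
    n * (n * k₂ ^ 2) * (n * (2 * s') ^ 2)), min (1 / 2) (η / (4 * s + 1)), by positivity,
    min_le_left _ _, fun t δ hδ ht htδ => ?_⟩
  have hδ1 : δ ≤ 1 / 2 := hδ.trans (min_le_left _ _)
  have hδ2 : δ ≤ η / (4 * s + 1) := hδ.trans (min_le_right _ _)
  -- The sign of `δ` comes from the bound itself, which holds at some point because `P` is a
  -- probability measure.
  have hδ0 : 0 ≤ δ := by
    obtain ⟨x, hx⟩ := htδ.exists
    exact (abs_nonneg _).trans hx
  set ρ : X → ℝ := fun x => (t x - 1) / (t x + ν) with hρdef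
  have hρ : AEStronglyMeasurable ρ P :=
    ((ht.aemeasurable.sub_const 1).div (ht.aemeasurable.add_const ν)).aestronglyMeasurable
  have hthalf : ∀ᵐ x ∂P, 1 / 2 ≤ t x := by
    filter_upwards [htδ] with x hx
    have := (abs_le.1 hx).1
    linarith
  have hb : ∀ᵐ x ∂P, |ρ x| ≤ 2 * δ := by
    filter_upwards [htδ, hthalf] with x hx hx2
    rw [abs_div, abs_of_pos (by positivity : 0 < t x + ν), div_le_iff₀ (by positivity)]
    nlinarith
  have hw : ∀ᵐ x ∂P, ν / (t x + ν) = ν / (1 + ν) * (1 - ρ x) := by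
    filter_upwards [hthalf] with x hx
    have : t x + ν ≠ 0 := by positivity
    simp only [hρdef]
    field_simp
    ring
  set U := secondMoment P u ρ with hU
  have hUb : ∀ i j, |U i j| ≤ 2 * δ * s := hs ▸ abs_secondMoment_apply_le hGu hρ hb
  have hfb : ∀ i, |firstMoment P u ρ i| ≤ 2 * δ * s' := hs' ▸ abs_firstMoment_apply_le hGu hρ hb
  have hUη : ∀ i j, |U i j| < η := fun i j => by
    refine (hUb i j).trans_lt ?_
    rw [le_div_iff₀ (by positivity)] at hδ2
    rcases hδ0.eq_or_lt with h | h
    · rw [← h]; simpa using hη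
    · nlinarith
  have hAc : (secondMoment P G fun x => ν / (t x + ν)) = (ν / (1 + ν)) • (J - J * U * J) := by
    rw [secondMoment_congr (hw.mono fun _ => Or.inr), secondMoment_mul_one_sub hG hρ hb, hU,
      ← secondMoment_eq_conj hG hJ hu hρ hb, hJ]
  have hwi := integrable_mul_coord_mul_coord (c := 1) (w := fun x => ν / (t x + ν)) hG
    (((aestronglyMeasurable_const.sub hρ).const_mul _).congr (hw.mono fun _ h => h.symm)) (by
      filter_upwards [hthalf] with x hx
      rw [abs_of_nonneg (by positivity), div_le_one (by positivity)]
      linarith)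
  have hAu : IsUnit (J - J * U * J).det := by
    have h : IsUnit (secondMoment P G fun x => ν / (t x + ν)).det := by
      refine isUnit_det_secondMoment hG hwi ?_ ?_ (hJ ▸ hu)
      · filter_upwards [hthalf] with x hx
        positivity
      · filter_upwards [hthalf] with x hx
        right; positivity
    rw [hAc, det_smul] at h
    exact isUnit_of_mul_isUnit_right h
  obtain ⟨e, he0, he, heq⟩ := exists_errorOfMoments_eq hG hJ hu hm hρ hb hU hAu T ν
    (c := ν / (1 + ν)) (by positivity)
  have hAb := hbd U hUη
  have hJs : (J⁻¹)ᵀ = J⁻¹ := by rw [transpose_nonsing_inv, hJ, (secondMoment_isSymm _).eq]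
  have hui : Integrable (fun x => u x ⬝ᵥ u x) P :=
    integrable_finsetSum _ fun i _ => (hGu i).integrable_mul (hGu i)
  -- `E[u uᵀ] = J⁻¹ J J⁻¹ = J⁻¹`.
  have hsJ : J⁻¹.trace = s := by
    have h1 := trace_secondMoment (ρ := fun _ => (1 : ℝ)) (b := 1) hGu aestronglyMeasurable_const
      (by simp)
    simp_rw [one_mul] at h1
    rw [hs, ← h1, secondMoment_mulVec (integrable_mul_coord_mul_coord hG
      (w := fun _ => 1) (c := 1) aestronglyMeasurable_const (by simp)), ← hJ, hJs,
      nonsing_inv_mul _ hu, Matrix.one_mul]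
  have hUt : |U.trace - (∫ x, t x * (u x ⬝ᵥ u x) ∂P - s) / (1 + ν)| ≤ 2 * s * δ ^ 2 := by
    have hti : Integrable (fun x => t x * (u x ⬝ᵥ u x)) P := by
      refine hui.bdd_mul (c := 2) ht ?_
      filter_upwards [htδ] with x hx
      rw [Real.norm_eq_abs, abs_le]
      have := abs_le.1 hx
      constructor <;> linarith
    have hρi : Integrable (fun x => ρ x * (u x ⬝ᵥ u x)) P := hui.bdd_mul hρ hb
    have hdi : Integrable (fun x => (t x * (u x ⬝ᵥ u x) - u x ⬝ᵥ u x) / (1 + ν)) P :=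
      (hti.sub hui).div_const _
    rw [show U.trace = ∫ x, ρ x * (u x ⬝ᵥ u x) ∂P from trace_secondMoment hGu hρ hb, hs,
      ← integral_sub hti hui, ← integral_div, ← integral_sub hρi hdi]
    rw [mul_right_comm, ← integral_const_mul]
    refine (abs_integral_le_integral_abs).trans (integral_mono_ae
      (hρi.sub hdi).abs (hui.const_mul _) ?_)
    filter_upwards [htδ, hthalf] with x hx hx2
    have h0 : 0 ≤ u x ⬝ᵥ u x := Finset.sum_nonneg fun i _ => mul_self_nonneg _
    have e1 : ρ x * (u x ⬝ᵥ u x) - (t x * (u x ⬝ᵥ u x) - u x ⬝ᵥ u x) / (1 + ν) =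
        -((t x - 1) ^ 2 / ((t x + ν) * (1 + ν))) * (u x ⬝ᵥ u x) := by
      have : t x + ν ≠ 0 := by positivity
      simp only [hρdef]
      field_simp
      ring
    simp only [e1, abs_mul, abs_neg, abs_of_nonneg h0]
    refine mul_le_mul_of_nonneg_right ?_ h0
    rw [abs_of_nonneg (by positivity), div_le_iff₀ (by positivity), ← sq_abs]
    have h3 : |t x - 1| ^ 2 ≤ δ ^ 2 := by gcongr
    have h4 : 1 / 2 ≤ (t x + ν) * (1 + ν) := by nlinarith
    nlinarith [sq_nonneg δ]
  have hrem : |(U * (J * (J - J * U * J)⁻¹ * J) * U).trace| ≤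
      n * (n * (n * (2 * s * k₁) * (2 * s))) * δ ^ 2 := by
    have h := abs_trace_mul_conj_mul_le (a := 2 * δ * s)
      (mul_nonneg (mul_nonneg zero_le_two hδ0) hs0) hc0 hκ hUb hc hAb
    refine h.trans_eq ?_
    simp only [hk₁, ← hn]
    ring
  have hee : e ≤ n * (n * k₂ ^ 2) * (n * (2 * s') ^ 2) * δ ^ 2 := by
    have h := dotProduct_mul_mulVec_self_le (a := 2 * δ * s') hκ hAb hc hfb
    refine (he.trans h).trans_eq ?_
    simp only [hk₂, ← hn]
    ring
  rw [secondMoment_congr (hw.mono fun _ => Or.inr), firstMoment_congr (hw.mono fun _ => Or.inr),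
    heq, ← hM, hsJ]
  -- An exact identity: the discrepancy is a prefactor times the three quadratic quantities bounded
  -- above.
  have e2 : (ν + 1) / T * ((ν / (1 + ν))⁻¹ * (s + U.trace +
        (U * (J * (J - J * U * J)⁻¹ * J) * U).trace) - (ν + 1) / ν * (M.trace + e)) -
      ((1 + ν) ^ 2 / (T * ν) * (s - M.trace) + (1 + ν) / (T * ν) *
          (∫ x, t x * (u x ⬝ᵥ u x) ∂P - s)) =
      (1 + ν) ^ 2 / (T * ν) * ((U.trace - (∫ x, t x * (u x ⬝ᵥ u x) ∂P - s) / (1 + ν)) +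
        (U * (J * (J - J * U * J)⁻¹ * J) * U).trace - e) := by
    field_simp
    ring
  have e3 : 0 ≤ (1 + ν) ^ 2 / (T * ν) := by positivity
  rw [e2, abs_mul, abs_of_nonneg e3, mul_assoc _ _ (δ ^ 2)]
  refine mul_le_mul_of_nonneg_left ?_ e3
  have := abs_le.1 hUt
  have := abs_le.1 hrem
  rw [abs_le]
  constructor <;> linarith

end NearData

/-! ### Scores of normalized and unnormalized models -/

section Model

variable {X ι : Type*} [Fintype ι] {p : EuclideanSpace ℝ ι → X → ℝ} {β₀ : EuclideanSpace ℝ ι}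

theorem smul_innerSL_score {x : X} (hx : 0 < p β₀ x)
    (hd : DifferentiableAt ℝ (fun β => p β x) β₀) :
    p β₀ x • innerSL ℝ (score p β₀ x) = fderiv ℝ (fun β => p β x) β₀ := by
  ext v
  rw [_root_.smul_apply, innerSL_apply_apply, score,
    inner_gradient_left, fderiv.log hd hx.ne', _root_.smul_apply, smul_eq_mul,
    smul_eq_mul, mul_inv_cancel_left₀ hx.ne']

/-- Moving only the log-normalization constant by `s` multiplies the model by `exp (-s)`, so its
logarithmic derivative in that direction is `-1`. -/
theorem IsUnnormalizedModel.exists_score_eq [DecidableEq ι] (h : IsUnnormalizedModel p β₀) :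
    ∃ j, ∀ x, 0 < p β₀ x → DifferentiableAt ℝ (fun β => p β x) β₀ → score p β₀ x j = -1 := by
  obtain ⟨j, q, hq⟩ := h
  refine ⟨j, fun x hx hd => ?_⟩
  set v : EuclideanSpace ℝ ι := EuclideanSpace.single j 1 with hv
  have hline : HasDerivAt (fun s : ℝ => β₀ + s • v) v 0 := by
    simpa using ((hasDerivAt_id (0 : ℝ)).smul_const v).const_add β₀
  have h1 : HasDerivAt (fun s : ℝ => p (β₀ + s • v) x) (fderiv ℝ (fun β => p β x) β₀ v) 0 := by
    have hd' : HasFDerivAt (fun β => p β x) (fderiv ℝ (fun β => p β x) β₀)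
        (β₀ + (0 : ℝ) • v) := by
      simpa using hd.hasFDerivAt
    exact hd'.comp_hasDerivAt (0 : ℝ) hline
  have h2 : HasDerivAt (fun s : ℝ => p β₀ x * Real.exp (-s)) (-p β₀ x) 0 := by
    simpa using ((hasDerivAt_neg (0 : ℝ)).exp).const_mul (p β₀ x)
  have hlim : Tendsto (fun s : ℝ => β₀ + s • v) (𝓝 0) (𝓝 β₀) := by
    simpa using hline.continuousAt.tendsto
  have h3 : (fun s : ℝ => p (β₀ + s • v) x) =ᶠ[𝓝 0] fun s : ℝ => p β₀ x * Real.exp (-s) := by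
    filter_upwards [hlim.eventually hq] with s hs
    rw [hs x, hq.self_of_nhds x]
    have e1 : (fun i : {i : ι // i ≠ j} => (β₀ + s • v) i) =
        fun i : {i : ι // i ≠ j} => β₀ i := by
      ext i
      simp [hv, i.2]
    have e2 : (β₀ + s • v) j = β₀ j + s := by simp [hv]
    rw [e1, e2, Real.exp_add, Real.exp_neg]
    field_simp
  have h4 := h1.unique (h2.congr_of_eventuallyEq h3)
  rw [← smul_innerSL_score hx hd] at h4
  simp only [_root_.smul_apply, innerSL_apply_apply, smul_eq_mul, hv,
    EuclideanSpace.inner_single_right] at h4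
  have : p β₀ x * score p β₀ x j = p β₀ x * -1 := by simpa using h4
  exact mul_left_cancel₀ hx.ne' this

variable [MeasurableSpace X] {μ : Measure X}

/-- The score of a normalized model is centered. -/
theorem IsNormalizedModel.integral_mul_score_eq_zero (h : IsNormalizedModel μ p β₀)
    (h0 : ∀ᶠ β in 𝓝 β₀, ∀ x, 0 ≤ p β x) (hint : ∀ᶠ β in 𝓝 β₀, Integrable (p β) μ)
    (hs : Integrable (fun x => p β₀ x • score p β₀ x) μ) (i : ι) :
    ∫ x, p β₀ x * score p β₀ x i ∂μ = 0 := by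
  obtain ⟨r, hr, B, hB, hdom⟩ := h.dominated
  have hF : ∀ᵐ x ∂μ, HasFDerivAt (fun β => p β x) (innerSL ℝ (p β₀ x • score p β₀ x)) β₀ := by
    filter_upwards [h.differentiableAt] with x hx
    have e : innerSL ℝ (p β₀ x • score p β₀ x) = fderiv ℝ (fun β => p β x) β₀ := by
      -- Where `p β₀ x = 0`, nonnegativity makes `β₀` a local minimum. The derivative is then zero
      -- and agrees with `p • score`, whatever value the score takes there.
      rcases (h0.self_of_nhds x).eq_or_lt with h' | h'
      · have hmin : IsLocalMin (fun β => p β x) β₀ := by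
          filter_upwards [h0] with β hβ
          rw [← h']
          exact hβ x
        rw [hmin.fderiv_eq_zero, ← h', zero_smul, map_zero]
      · rw [map_smul, smul_innerSL_score h' hx]
    rw [e]
    exact hx.hasFDerivAt
  have hFint : Integrable (fun x => innerSL ℝ (p β₀ x • score p β₀ x)) μ :=
    (innerSL ℝ (E := EuclideanSpace ℝ ι)).integrable_comp hs
  -- Measurability of `p β` is known only where it is integrable, so the ball is cut down to those
  -- parameters.
  obtain ⟨-, hder⟩ := hasFDerivAt_integral_of_dominated_loc_of_lip'
    (F := fun β x => p β x) (s := Metric.ball β₀ r ∩ {β | Integrable (p β) μ})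
    (inter_mem (Metric.ball_mem_nhds _ hr) hint) (fun β hβ => hβ.2.aestronglyMeasurable)
    hint.self_of_nhds hFint.aestronglyMeasurable
    (hdom.mono fun x hx β hβ => hx β hβ.1) hB hF
  have hc : HasFDerivAt (fun β => ∫ x, p β x ∂μ) (0 : EuclideanSpace ℝ ι →L[ℝ] ℝ) β₀ :=
    (hasFDerivAt_const (1 : ℝ) β₀).congr_of_eventuallyEq h.integral_eq_one
  have := congrArg (fun L => L (EuclideanSpace.basisFun ι ℝ i)) (hder.unique hc)
  simp only [_root_.zero_apply] at this
  rw [← this, ContinuousLinearMap.integral_apply hFint]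
  refine integral_congr_ae (.of_forall fun x => ?_)
  classical
  simp [EuclideanSpace.inner_single_right]

end Model

/-! ### The chi-squared divergence and its zeros -/

section Divergence

variable {X : Type*} [MeasurableSpace X] {μ : Measure X} {q r : X → ℝ}

/-- If the integral is finite, `q` vanishes almost everywhere that `r` does, and `∫ q² / r - 1 = ∫
(q - r)² / r`. This is nonnegative, and zero only if `q = r` almost everywhere. -/
theorem one_le_lintegral_sq_div (hq : IsDensity μ q) (hr : IsDensity μ r) :
    1 ≤ ∫⁻ x, ENNReal.ofReal (q x) ^ 2 / ENNReal.ofReal (r x) ∂μ ∧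
      (∫⁻ x, ENNReal.ofReal (q x) ^ 2 / ENNReal.ofReal (r x) ∂μ = 1 → r =ᵐ[μ] q) := by
  set L := ∫⁻ x, ENNReal.ofReal (q x) ^ 2 / ENNReal.ofReal (r x) ∂μ with hL
  rcases eq_or_ne L ⊤ with h | h
  · simp [h]
  have hqm := hq.integrable.aestronglyMeasurable.aemeasurable
  have hrm := hr.integrable.aestronglyMeasurable.aemeasurable
  have hfin : ∀ᵐ x ∂μ, ENNReal.ofReal (q x) ^ 2 / ENNReal.ofReal (r x) < ⊤ :=
    ae_lt_top' ((hqm.ennreal_ofReal.pow_const 2).div hrm.ennreal_ofReal) h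
  have h0 : ∀ᵐ x ∂μ, r x = 0 → q x = 0 := by
    filter_upwards [hfin] with x hx hrx
    by_contra hne
    have hpos := (hq.nonneg x).lt_of_ne' hne
    rw [hrx, ENNReal.ofReal_zero, ENNReal.div_zero (by simpa using hpos)] at hx
    exact hx.ne rfl
  have hLe : L = ∫⁻ x, ENNReal.ofReal (q x ^ 2 / r x) ∂μ := by
    refine lintegral_congr_ae ?_
    filter_upwards [h0] with x hx
    rcases (hr.nonneg x).eq_or_lt with hrx | hrx
    · simp [hx hrx.symm]
    · rw [ENNReal.ofReal_div_of_pos hrx, ENNReal.ofReal_pow (hq.nonneg x)]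
  have hn : 0 ≤ᵐ[μ] fun x => q x ^ 2 / r x :=
    .of_forall fun x => div_nonneg (sq_nonneg _) (hr.nonneg x)
  have hint : Integrable (fun x => q x ^ 2 / r x) μ :=
    (lintegral_ofReal_ne_top_iff_integrable
      ((hqm.pow_const 2).div hrm).aestronglyMeasurable hn).1 (hLe ▸ h)
  rw [← ofReal_integral_eq_lintegral_ofReal hint hn] at hLe
  have hpt : ∀ᵐ x ∂μ, q x ^ 2 / r x - 2 * q x + r x = (q x - r x) ^ 2 / r x := by
    filter_upwards [h0] with x hx
    rcases eq_or_ne (r x) 0 with hrx | hrx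
    · simp [hx hrx, hrx]
    · field_simp
      ring
  have hint₁ : Integrable (fun x => q x ^ 2 / r x - 2 * q x) μ :=
    hint.sub (hq.integrable.const_mul 2)
  have hint' : Integrable (fun x => q x ^ 2 / r x - 2 * q x + r x) μ := hint₁.add hr.integrable
  have hval : ∫ x, (q x - r x) ^ 2 / r x ∂μ = ∫ x, q x ^ 2 / r x ∂μ - 1 := by
    rw [← integral_congr_ae hpt, integral_add hint₁ hr.integrable,
      integral_sub hint (hq.integrable.const_mul 2), integral_const_mul, hq.integral_eq_one,
      hr.integral_eq_one]
    ring
  have hn' : 0 ≤ᵐ[μ] fun x => (q x - r x) ^ 2 / r x :=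
    .of_forall fun x => div_nonneg (sq_nonneg _) (hr.nonneg x)
  have hge := integral_nonneg_of_ae hn'
  rw [hval] at hge
  refine ⟨?_, fun h1 => ?_⟩
  · rw [hLe, ENNReal.one_le_ofReal]
    linarith
  · rw [hLe, ENNReal.ofReal_eq_one] at h1
    rw [h1, sub_self, integral_eq_zero_iff_of_nonneg_ae hn' (hint'.congr hpt)] at hval
    filter_upwards [hval, h0] with x hx hx0
    rcases eq_or_ne (r x) 0 with hrx | hrx
    · rw [hx0 hrx, hrx]
    · have : (q x - r x) ^ 2 / r x = 0 := hx
      rw [div_eq_zero_iff, or_iff_left hrx, sq_eq_zero_iff, sub_eq_zero] at this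
      exact this.symm

theorem chiSq_eq_zero_iff (hq : IsDensity μ q) (hr : IsDensity μ r) :
    chiSq μ q r = 0 ↔ r =ᵐ[μ] q := by
  obtain ⟨h1, h2⟩ := one_le_lintegral_sq_div hq hr
  rw [chiSq, tsub_eq_zero_iff_le]
  refine ⟨fun h => h2 (h.antisymm h1), fun h => ?_⟩
  have : ∫⁻ x, ENNReal.ofReal (q x) ^ 2 / ENNReal.ofReal (r x) ∂μ =
      ∫⁻ x, ENNReal.ofReal (q x) ∂μ := by
    refine lintegral_congr_ae (h.mono fun x hx => ?_)
    rcases eq_or_ne (ENNReal.ofReal (q x)) 0 with h0 | h0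
    · simp [hx, h0]
    · simp only [hx]
      rw [sq, ENNReal.mul_div_cancel_right h0 ENNReal.ofReal_ne_top]
  rw [this, ← ofReal_integral_eq_lintegral_ofReal hq.integrable (.of_forall hq.nonneg),
    hq.integral_eq_one, ENNReal.ofReal_one]

theorem one_add_chiSq (hq : IsDensity μ q) (hr : IsDensity μ r) :
    1 + chiSq μ q r = ∫⁻ x, ENNReal.ofReal (q x) ^ 2 / ENNReal.ofReal (r x) ∂μ :=
  add_tsub_cancel_of_le (one_le_lintegral_sq_div hq hr).1

end Divergence

/-! ### Passing from the base measure to the data distribution -/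

section DataMeasure

variable {X : Type*} [MeasurableSpace X] {μ : Measure X} {q : X → ℝ}

theorem ae_withDensity_ofReal_iff (hq : IsDensity μ q) {s : X → Prop} :
    (∀ᵐ x ∂μ.withDensity fun x => ENNReal.ofReal (q x), s x) ↔ ∀ᵐ x ∂μ, 0 < q x → s x := by
  rw [ae_withDensity_iff' hq.integrable.aestronglyMeasurable.aemeasurable.ennreal_ofReal]
  simp

theorem isProbabilityMeasure_withDensity (hq : IsDensity μ q) :
    IsProbabilityMeasure (μ.withDensity fun x => ENNReal.ofReal (q x)) := by
  refine ⟨?_⟩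
  rw [withDensity_apply _ MeasurableSet.univ, Measure.restrict_univ,
    ← ofReal_integral_eq_lintegral_ofReal hq.integrable (.of_forall hq.nonneg),
    hq.integral_eq_one, ENNReal.ofReal_one]

theorem integral_withDensity_ofReal (hq : IsDensity μ q) (f : X → ℝ) :
    ∫ x, f x ∂μ.withDensity (fun x => ENNReal.ofReal (q x)) = ∫ x, q x * f x ∂μ := by
  rw [integral_withDensity_eq_integral_toReal_smul₀
    hq.integrable.aestronglyMeasurable.aemeasurable.ennreal_ofReal (by simp)]
  simp_rw [ENNReal.toReal_ofReal (hq.nonneg _), smul_eq_mul]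

theorem integrable_withDensity_ofReal_iff {E : Type*} [NormedAddCommGroup E] [NormedSpace ℝ E]
    (hq : IsDensity μ q) {f : X → E} :
    Integrable f (μ.withDensity fun x => ENNReal.ofReal (q x)) ↔
      Integrable (fun x => q x • f x) μ := by
  rw [integrable_withDensity_iff_integrable_smul₀'
    hq.integrable.aestronglyMeasurable.aemeasurable.ennreal_ofReal (by simp)]
  simp_rw [ENNReal.toReal_ofReal (hq.nonneg _)]

variable {ι : Type*} (g : X → EuclideanSpace ℝ ι) (w : X → ℝ)

theorem scoreCov_eq_secondMoment (hq : IsDensity μ q) : scoreCov μ q g w =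
    secondMoment (μ.withDensity fun x => ENNReal.ofReal (q x)) (fun x => (g x).ofLp) w := by
  ext i j
  simp only [scoreCov, secondMoment, of_apply]
  rw [integral_withDensity_ofReal hq]
  simp_rw [mul_comm (q _)]

theorem scoreMean_eq_firstMoment (hq : IsDensity μ q) : scoreMean μ q g w =
    firstMoment (μ.withDensity fun x => ENNReal.ofReal (q x)) (fun x => (g x).ofLp) w := by
  ext i
  simp only [scoreMean, firstMoment]
  rw [integral_withDensity_ofReal hq]
  simp_rw [mul_comm (q _)]

end DataMeasure

theorem metricNorm_sq_eq {ι : Type*} [Fintype ι] [DecidableEq ι] {A : Matrix ι ι ℝ}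
    (hA : A.IsSymm) (v : EuclideanSpace ℝ ι) :
    metricNorm (A ^ 2) v = ‖WithLp.toLp 2 (A *ᵥ v.ofLp)‖ := by
  have : v.ofLp ⬝ᵥ (A ^ 2 *ᵥ v.ofLp) = (A *ᵥ v.ofLp) ⬝ᵥ (A *ᵥ v.ofLp) := by
    rw [sq, ← mulVec_mulVec, dotProduct_mulVec, ← mulVec_transpose, hA.eq]
  rw [metricNorm, this, EuclideanSpace.norm_eq, dotProduct]
  simp_rw [Real.norm_eq_abs, sq_abs, sq]

theorem norm_toLp_sq {ι : Type*} [Fintype ι] (v : ι → ℝ) : ‖WithLp.toLp 2 v‖ ^ 2 = v ⬝ᵥ v := by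
  rw [EuclideanSpace.real_norm_sq_eq, dotProduct]
  simp_rw [sq]

/-! ### The divergence as a moment of the density ratio -/

section DensityRatio

variable {X : Type*} [MeasurableSpace X] {μ : Measure X} {pd pn w : X → ℝ}

theorem isDensity_normProd (hpd : IsDensity μ pd) (hw : ∀ x, 0 ≤ w x)
    (hi : Integrable (fun x => pd x * w x) μ) (hZ : 0 < ∫ x, pd x * w x ∂μ) :
    IsDensity μ (normProd μ pd w) where
  nonneg x := div_nonneg (mul_nonneg (hpd.nonneg x) (hw x)) hZ.le
  integrable := hi.div_const _
  integral_eq_one := by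
    simp only [normProd]
    rw [integral_div, div_self hZ.ne']

theorem lintegral_normProd_sq_div (hpd : IsDensity μ pd) (hpn : IsDensity μ pn)
    (hw : ∀ x, 0 ≤ w x) (hZ : 0 < ∫ x, pd x * w x ∂μ)
    (hwm : AEStronglyMeasurable w (μ.withDensity fun x => ENNReal.ofReal (pd x)))
    (hpos : ∀ᵐ x ∂μ, 0 < pd x → w x ≠ 0 → 0 < pn x) :
    ∫⁻ x, ENNReal.ofReal (normProd μ pd w x) ^ 2 / ENNReal.ofReal (pn x) ∂μ =
      ∫⁻ x, ENNReal.ofReal (pd x / pn x * w x ^ 2 / (∫ x, pd x * w x ∂μ) ^ 2)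
        ∂μ.withDensity fun x => ENNReal.ofReal (pd x) := by
  have hpdm := hpd.integrable.aestronglyMeasurable.aemeasurable
  have hpnm := hpn.integrable.aestronglyMeasurable.aemeasurable
  have hac := withDensity_absolutelyContinuous μ fun x => ENNReal.ofReal (pd x)
  have hm : AEMeasurable (fun x => pd x / pn x * w x ^ 2 / (∫ x, pd x * w x ∂μ) ^ 2)
      (μ.withDensity fun x => ENNReal.ofReal (pd x)) :=
    (((hpdm.div hpnm).mono_ac hac).mul (hwm.aemeasurable.pow_const 2)).div_const _
  rw [lintegral_withDensity_eq_lintegral_mul₀' hpdm.ennreal_ofReal hm.ennreal_ofReal]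
  refine lintegral_congr_ae ?_
  filter_upwards [hpos] with x hx
  simp only [Pi.mul_apply, normProd]
  -- The two sides treat `pn x = 0` differently (`∞` in `ENNReal`, `0` in `ℝ`). Positivity of `pn`
  -- where `pd * w ≠ 0` excludes this, and elsewhere both sides vanish.
  rcases (hpd.nonneg x).eq_or_lt with h1 | h1
  · simp [← h1]
  rcases eq_or_ne (w x) 0 with h2 | h2
  · simp [h2]
  have h3 := hx h1 h2
  have h4 := (hw x).lt_of_ne' h2
  rw [← ENNReal.ofReal_pow (by positivity), ← ENNReal.ofReal_div_of_pos h3,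
    ← ENNReal.ofReal_mul h1.le]
  congr 1
  field_simp

/-- With `w = ‖u‖` this identifies the coefficient `E[t ‖u‖²]` of the expansions with `K (1 + χ²)`,
and its integrability with finiteness of the divergence. -/
theorem one_add_chiSq_normProd (hpd : IsDensity μ pd) (hpn : IsDensity μ pn)
    (hw : ∀ x, 0 ≤ w x) (hi : Integrable (fun x => pd x * w x) μ) (hZ : 0 < ∫ x, pd x * w x ∂μ)
    (hwm : AEStronglyMeasurable w (μ.withDensity fun x => ENNReal.ofReal (pd x)))
    (hpos : ∀ᵐ x ∂μ, 0 < pd x → w x ≠ 0 → 0 < pn x) :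
    (chiSq μ (normProd μ pd w) pn ≠ ⊤ ↔ Integrable (fun x => pd x / pn x * w x ^ 2)
      (μ.withDensity fun x => ENNReal.ofReal (pd x))) ∧
    (chiSq μ (normProd μ pd w) pn ≠ ⊤ →
      (∫ x, pd x * w x ∂μ) ^ 2 * (1 + (chiSq μ (normProd μ pd w) pn).toReal) =
        ∫ x, pd x / pn x * w x ^ 2 ∂μ.withDensity fun x => ENNReal.ofReal (pd x)) := by
  set Z := ∫ x, pd x * w x ∂μ with hZdef
  set P := μ.withDensity fun x => ENNReal.ofReal (pd x) with hP
  set D := chiSq μ (normProd μ pd w) pn with hD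
  have hpdm := hpd.integrable.aestronglyMeasurable.aemeasurable
  have hpnm := hpn.integrable.aestronglyMeasurable.aemeasurable
  have hac : P ≪ μ := withDensity_absolutelyContinuous μ _
  have hm : AEStronglyMeasurable (fun x => pd x / pn x * w x ^ 2 / Z ^ 2) P :=
    ((((hpdm.div hpnm).mono_ac hac).mul
      (hwm.aemeasurable.pow_const 2)).div_const _).aestronglyMeasurable
  have hn : 0 ≤ᵐ[P] fun x => pd x / pn x * w x ^ 2 / Z ^ 2 := .of_forall fun x =>
    div_nonneg (mul_nonneg (div_nonneg (hpd.nonneg x) (hpn.nonneg x)) (sq_nonneg _)) (sq_nonneg _)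
  have h1 := one_add_chiSq (isDensity_normProd hpd hw hi hZ) hpn
  rw [lintegral_normProd_sq_div hpd hpn hw hZ hwm hpos, ← hD, ← hZdef, ← hP] at h1
  have hiff : D ≠ ⊤ ↔ Integrable (fun x => pd x / pn x * w x ^ 2 / Z ^ 2) P := by
    rw [← lintegral_ofReal_ne_top_iff_integrable hm hn, ← h1]
    simp
  have hZ2 : Z ^ 2 ≠ 0 := by positivity
  refine ⟨hiff.trans ⟨fun h => ?_, fun h => h.div_const _⟩, fun h => ?_⟩
  · refine (h.mul_const (Z ^ 2)).congr (.of_forall fun x => ?_)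
    field_simp
  · rw [← ofReal_integral_eq_lintegral_ofReal (hiff.1 h) hn] at h1
    have h2 := congrArg ENNReal.toReal h1
    rw [ENNReal.toReal_add ENNReal.one_ne_top h, ENNReal.toReal_one,
      ENNReal.toReal_ofReal (integral_nonneg_of_ae hn), integral_div] at h2
    rw [h2]
    field_simp

end DensityRatio

theorem noisePosterior_eq_div {X : Type*} {pd pn : X → ℝ} {x : X} (hn : 0 < pn x) (ν : ℝ) :
    noisePosterior pd pn ν x = ν / (pd x / pn x + ν) := by
  rw [noisePosterior, div_add' _ _ _ hn.ne', div_div_eq_mul_div]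

/-- The rest of the argument uses the kind of model only through this alternative. -/
theorem firstMoment_score_eq_zero_or {X : Type*} [MeasurableSpace X] {μ : Measure X}
    {ι : Type*} [Fintype ι] [DecidableEq ι]
    {p : EuclideanSpace ℝ ι → X → ℝ} {β₀ : EuclideanSpace ℝ ι} (hreg : IsRegularModel μ p β₀)
    (hmodel : IsNormalizedModel μ p β₀ ∨ IsUnnormalizedModel p β₀) :
    firstMoment (μ.withDensity fun x => ENNReal.ofReal (p β₀ x))
        (fun x => (score p β₀ x).ofLp) (fun _ => 1) = 0 ∨
      ∃ j, ∀ᵐ x ∂μ.withDensity fun x => ENNReal.ofReal (p β₀ x), score p β₀ x j = -1 := by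
  have hpd := hreg.isDensity
  have := isProbabilityMeasure_withDensity hpd
  rcases hmodel with h | h
  · left
    ext i
    simp only [firstMoment, one_mul, Pi.zero_apply]
    rw [integral_withDensity_ofReal hpd]
    exact h.integral_mul_score_eq_zero hreg.nonneg hreg.integrable
      ((integrable_withDensity_ofReal_iff hpd).1 (hreg.memLp_score.integrable (by norm_num))) i
  · right
    obtain ⟨j, hj⟩ := h.exists_score_eq
    refine ⟨j, (ae_withDensity_ofReal_iff hpd).2 ?_⟩
    filter_upwards [hreg.differentiableAt] with x hx hx' using hj x hx' (hx hx')

end NCE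

/-! ### The main theorem -/

theorem theorem1 {X : Type*} [MeasurableSpace X] (μ : Measure X)
    {ι : Type*} [Fintype ι] [DecidableEq ι] [Nonempty ι]
    (p : EuclideanSpace ℝ ι → X → ℝ) (β₀ : EuclideanSpace ℝ ι)
    (hreg : NCE.IsRegularModel μ p β₀)
    (hmodel : NCE.IsNormalizedModel μ p β₀ ∨ NCE.IsUnnormalizedModel p β₀)
    (T : ℝ) (hT : 0 < T) :
    let pd : X → ℝ := p β₀
    let g : X → EuclideanSpace ℝ ι := NCE.score p β₀
    let I : Matrix ι ι ℝ := NCE.fisher μ pd g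
    let m : ι → ℝ := NCE.scoreMean μ pd g (fun _ => 1)
    let M : Matrix ι ι ℝ := I⁻¹ * Matrix.vecMulVec m m * I⁻¹
    let w₁ : X → ℝ := fun x => NCE.metricNorm (I⁻¹ ^ 2) (g x)
    let K : ℝ := (∫ x, pd x * w₁ x ∂μ) ^ 2
    let popt : X → ℝ := NCE.normProd μ pd w₁
    let D : (X → ℝ) → ENNReal := fun pn => NCE.chiSq μ popt pn
    let Admissible : (X → ℝ) → Prop := fun pn =>
      NCE.IsDensity μ pn ∧ ∀ᵐ x ∂μ, 0 < pd x → g x ≠ 0 → 0 < pn x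
    -- the optimal noise is an admissible density, proportional to `pd * ‖I⁻¹ g‖`
    (0 < K ∧ Admissible popt ∧
      ∀ x, popt x = pd x * ‖WithLp.toLp 2 (I⁻¹ *ᵥ (g x).ofLp)‖ /
        ∫ y, pd y * ‖WithLp.toLp 2 (I⁻¹ *ᵥ (g y).ofLp)‖ ∂μ) ∧
    -- for an admissible noise the matrix `I_w` in the error is invertible
    (∀ pn, Admissible pn → ∀ ν : ℝ, 0 < ν →
      IsUnit (NCE.scoreCov μ pd g (NCE.noisePosterior pd pn ν)).det) ∧
    -- expansion of the error up to `o(1)` in the all-noise limit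
    (∀ pn, Admissible pn → D pn ≠ ⊤ →
      Tendsto (fun ν : ℝ => NCE.mse μ pd g T ν pn - ν / T * (I⁻¹ - M).trace) atTop
        (𝓝 (1 / T * ((I⁻¹ - (2 : ℝ) • M).trace + K * (1 + (D pn).toReal))))) ∧
    (∀ pn, Admissible pn → D pn = ⊤ →
      Tendsto (fun ν : ℝ => NCE.mse μ pd g T ν pn - ν / T * (I⁻¹ - M).trace) atTop atTop) ∧
    -- the optimal noise is the unique minimizer of the divergence over all densities
    (∀ pn, NCE.IsDensity μ pn → (D pn = 0 ↔ pn =ᵐ[μ] popt)) ∧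
    -- and it beats every other admissible noise in the all-noise limit
    (∀ pn, Admissible pn → ¬ pn =ᵐ[μ] popt →
      ∀ᶠ ν : ℝ in atTop, NCE.mse μ pd g T ν popt < NCE.mse μ pd g T ν pn) ∧
    -- first-order expansion, at fixed `ν`, for noise close to the data, `pd / pn = 1 + ε`
    (∀ ν : ℝ, 0 < ν → ∃ C : ℝ, ∃ δ₀ > 0, ∀ pn : X → ℝ, NCE.IsDensity μ pn →
      ∀ (ε : X → ℝ) (δ : ℝ), δ ≤ δ₀ → (∀ᵐ x ∂μ, pd x = (1 + ε x) * pn x ∧ |ε x| ≤ δ) →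
        D pn ≠ ⊤ ∧
        |NCE.mse μ pd g T ν pn -
          ((1 + ν) ^ 2 / (T * ν) * (I⁻¹ - M).trace +
            (1 + ν) / (T * ν) * (K * (1 + (D pn).toReal) - I⁻¹.trace))| ≤ C * δ ^ 2) := by
  intro pd g I m M w₁ K popt D Admissible
  have hpd : NCE.IsDensity μ pd := hreg.isDensity
  set P : Measure X := μ.withDensity fun x => ENNReal.ofReal (pd x) with hP
  have hprob : IsProbabilityMeasure P := NCE.isProbabilityMeasure_withDensity hpd
  set G : X → ι → ℝ := fun x => (g x).ofLp with hGdef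
  have hG : ∀ i, MemLp (fun x => G x i) 2 P := fun i => hreg.memLp_score.eval_piLp i
  have hI : I = NCE.secondMoment P G fun _ => 1 := NCE.scoreCov_eq_secondMoment g _ hpd
  have hu : IsUnit I.det := hreg.isUnit_det_fisher
  have hm : m = NCE.firstMoment P G fun _ => 1 := NCE.scoreMean_eq_firstMoment g _ hpd
  have hM : M = I⁻¹ * Matrix.vecMulVec (NCE.firstMoment P G fun _ => 1)
      (NCE.firstMoment P G fun _ => 1) * I⁻¹ := by rw [← hm]
  have hcase : NCE.firstMoment P G (fun _ => 1) = 0 ∨ ∃ j, ∀ᵐ x ∂P, G x j = -1 :=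
    NCE.firstMoment_score_eq_zero_or hreg hmodel
  have hIs : (I⁻¹).IsSymm := by
    rw [IsSymm, transpose_nonsing_inv, hI, (NCE.secondMoment_isSymm _).eq]
  have hw : ∀ x, w₁ x = ‖WithLp.toLp 2 (I⁻¹ *ᵥ G x)‖ := fun x => NCE.metricNorm_sq_eq hIs (g x)
  have hw2 : ∀ x, w₁ x ^ 2 = (I⁻¹ *ᵥ G x) ⬝ᵥ (I⁻¹ *ᵥ G x) := fun x => by
    rw [hw, NCE.norm_toLp_sq]
  have hwn : ∀ x, 0 ≤ w₁ x := fun x => (hw x).symm ▸ norm_nonneg _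
  have hGw : ∀ x, w₁ x = 0 → G x = 0 := fun x hx => by
    rw [hw, norm_eq_zero, WithLp.toLp_eq_zero] at hx
    rw [← one_mulVec (G x), ← mul_nonsing_inv _ hu, ← mulVec_mulVec, hx, mulVec_zero]
  have hwg : ∀ x, w₁ x ≠ 0 → g x ≠ 0 := fun x hx h => hx (by simp [hw, hGdef, h])
  have hGu := NCE.memLp_mulVec hG I⁻¹
  have hwL : MemLp w₁ 2 P := by
    have : MemLp (fun x => WithLp.toLp 2 (I⁻¹ *ᵥ G x)) 2 P := MemLp.of_eval_piLp hGu
    exact this.norm.congr_norm this.norm.1 (.of_forall fun _ => rfl) |>.ae_eq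
      (.of_forall fun x => (hw x).symm)
  have hwi : Integrable w₁ P := hwL.integrable (by norm_num)
  have hpw : Integrable (fun x => pd x * w₁ x) μ :=
    (NCE.integrable_withDensity_ofReal_iff hpd).1 hwi
  -- If the integral were zero, the score would vanish `P`-almost everywhere and `I` would be `0`,
  -- which is singular because `ι` is nonempty.
  have hZ : 0 < ∫ x, pd x * w₁ x ∂μ := by
    rw [← NCE.integral_withDensity_ofReal hpd]
    refine (integral_nonneg hwn).lt_of_ne' fun h => ?_
    rw [integral_eq_zero_iff_of_nonneg hwn hwi] at h
    have hI0 : I = 0 := by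
      rw [hI, NCE.secondMoment_congr (w' := fun _ => 0) (h.mono fun x hx => Or.inl (hGw x hx))]
      ext i j
      simp [NCE.secondMoment]
    rw [hI0, det_zero] at hu
    exact not_isUnit_zero hu
  have hK : 0 < K := pow_pos hZ 2
  have hpopt : NCE.IsDensity μ popt := NCE.isDensity_normProd hpd hwn hpw hZ
  have hadm_opt : Admissible popt := by
    refine ⟨hpopt, .of_forall fun x hx hg => div_pos (mul_pos hx ?_) hZ⟩
    refine (hwn x).lt_of_ne' fun h => hg ?_
    exact (WithLp.ofLp_eq_zero 2).1 (hGw x h)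
  have hadm : ∀ pn, Admissible pn → ∀ᵐ x ∂P, G x = 0 ∨ 0 < pn x := fun pn hpn => by
    refine (NCE.ae_withDensity_ofReal_iff hpd).2 (hpn.2.mono fun x hx hx' => ?_)
    by_cases h : g x = 0
    · left; simp [hGdef, h]
    · exact Or.inr (hx hx' h)
  have htm : ∀ pn, NCE.IsDensity μ pn → AEStronglyMeasurable (fun x => pd x / pn x) P :=
    fun pn hpn => (hpd.integrable.aestronglyMeasurable.aemeasurable.div
      hpn.integrable.aestronglyMeasurable.aemeasurable).aestronglyMeasurable.mono_ac
      (withDensity_absolutelyContinuous μ _)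
  have ht0 : ∀ pn, NCE.IsDensity μ pn → ∀ᵐ x ∂P, 0 ≤ pd x / pn x := fun pn hpn =>
    .of_forall fun x => div_nonneg (hpd.nonneg x) (hpn.nonneg x)
  have hpost : ∀ pn, Admissible pn → ∀ ν : ℝ,
      ∀ᵐ x ∂P, G x = 0 ∨ NCE.noisePosterior pd pn ν x = ν / (pd x / pn x + ν) := fun pn hpn ν =>
    (hadm pn hpn).mono fun x hx => hx.imp_right fun h => NCE.noisePosterior_eq_div h ν
  have hcov : ∀ pn, Admissible pn → ∀ ν : ℝ,
      NCE.scoreCov μ pd g (NCE.noisePosterior pd pn ν) =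
        NCE.secondMoment P G fun x => ν / (pd x / pn x + ν) := fun pn hpn ν => by
    rw [NCE.scoreCov_eq_secondMoment g _ hpd]
    exact NCE.secondMoment_congr (hpost pn hpn ν)
  have hmse : ∀ pn, Admissible pn → ∀ ν : ℝ, NCE.mse μ pd g T ν pn = NCE.errorOfMoments T ν
      (NCE.secondMoment P G fun x => ν / (pd x / pn x + ν))
      (NCE.firstMoment P G fun x => ν / (pd x / pn x + ν)) := fun pn hpn ν => by
    rw [← hcov pn hpn ν, ← NCE.firstMoment_congr (hpost pn hpn ν),
      ← NCE.scoreMean_eq_firstMoment g _ hpd]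
    rfl
  have hD : ∀ pn, Admissible pn →
      (D pn ≠ ⊤ ↔ Integrable
        (fun x => pd x / pn x * ((I⁻¹ *ᵥ G x) ⬝ᵥ (I⁻¹ *ᵥ G x))) P) ∧
      (D pn ≠ ⊤ → K * (1 + (D pn).toReal) =
        ∫ x, pd x / pn x * ((I⁻¹ *ᵥ G x) ⬝ᵥ (I⁻¹ *ᵥ G x)) ∂P) := fun pn hpn => by
    have h := NCE.one_add_chiSq_normProd hpd hpn.1 hwn hpw hZ hwL.1
      (hpn.2.mono fun x hx h1 h2 => hx h1 (hwg x h2))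
    simp_rw [hw2] at h
    exact h
  have hlim : ∀ pn, Admissible pn → D pn ≠ ⊤ →
      Tendsto (fun ν : ℝ => NCE.mse μ pd g T ν pn - ν / T * (I⁻¹ - M).trace) atTop
        (𝓝 (1 / T * ((I⁻¹ - (2 : ℝ) • M).trace + K * (1 + (D pn).toReal)))) := by
    intro pn hpn hfin
    simp_rw [hmse pn hpn]
    rw [trace_sub, trace_sub, trace_smul, smul_eq_mul, (hD pn hpn).2 hfin]
    exact NCE.tendsto_errorOfMoments_allNoise hG hI hu hcase (htm pn hpn.1) (ht0 pn hpn.1)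
      ((hD pn hpn).1.1 hfin) T hM
  have hlim_top : ∀ pn, Admissible pn → D pn = ⊤ →
      Tendsto (fun ν : ℝ => NCE.mse μ pd g T ν pn - ν / T * (I⁻¹ - M).trace) atTop atTop := by
    intro pn hpn hinf
    simp_rw [hmse pn hpn]
    rw [trace_sub]
    exact NCE.tendsto_errorOfMoments_allNoise_atTop hG hI hu hcase (htm pn hpn.1) (ht0 pn hpn.1)
      (fun h => (hD pn hpn).1.2 h hinf) hT hM
  have hzero : ∀ pn, NCE.IsDensity μ pn → (D pn = 0 ↔ pn =ᵐ[μ] popt) := fun pn hpn =>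
    NCE.chiSq_eq_zero_iff hpopt hpn
  refine ⟨⟨hK, hadm_opt, fun x => ?_⟩, fun pn hpn ν hν => ?_, hlim, hlim_top, hzero,
    fun pn hpn hne => ?_, fun ν hν => ?_⟩
  · have : (fun y => pd y * w₁ y) = fun y => pd y * ‖WithLp.toLp 2 (I⁻¹ *ᵥ (g y).ofLp)‖ :=
      funext fun y => by rw [hw]
    simp only [popt, NCE.normProd]
    rw [this, hw]
  · rw [hcov pn hpn]
    have hb : ∀ᵐ x ∂P, |ν / (pd x / pn x + ν)| ≤ 1 := by
      filter_upwards [ht0 pn hpn.1] with x hx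
      rw [abs_of_nonneg (by positivity), div_le_one (by positivity)]
      linarith
    refine NCE.isUnit_det_secondMoment hG (NCE.integrable_mul_coord_mul_coord hG
      (((htm pn hpn.1).aemeasurable.add_const ν).const_div ν).aestronglyMeasurable hb) ?_ ?_
      (hI ▸ hu)
    · filter_upwards [ht0 pn hpn.1] with x hx
      positivity
    · filter_upwards [ht0 pn hpn.1] with x hx
      right; positivity
  -- The order-`ν` terms of the two errors coincide, so the constant terms decide, or the divergence
  -- to infinity when `D pn = ⊤`.
  · have hD0 : D popt = 0 := (hzero popt hpopt).2 (ae_eq_refl _)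
    have h1 := hlim popt hadm_opt (by simp [hD0])
    by_cases hfin : D pn = ⊤
    · have h2 := hlim_top pn hpn hfin
      filter_upwards [(h2.atTop_add h1.neg).eventually_gt_atTop 0] with ν hν
      linarith
    · have h2 := hlim pn hpn hfin
      have hpos : 0 < (D pn).toReal :=
        ENNReal.toReal_pos (fun h => hne ((hzero pn hpn.1).1 h)) hfin
      have hlt : 1 / T * ((I⁻¹ - (2 : ℝ) • M).trace + K * (1 + (D popt).toReal)) <
          1 / T * ((I⁻¹ - (2 : ℝ) • M).trace + K * (1 + (D pn).toReal)) := by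
        rw [hD0, ENNReal.toReal_zero]
        gcongr
      filter_upwards [h1.eventually_lt h2 hlt] with ν hν
      linarith
  · obtain ⟨C, δ₀, hδ₀, hδ₀', hC⟩ :=
      NCE.exists_abs_errorOfMoments_sub_le hG hI hu hcase hM hT hν
    refine ⟨C, δ₀, hδ₀, fun pn hpn ε δ hδ hε => ?_⟩
    -- The product form `pd = (1 + ε) * pn` forces `pd = 0` where `pn = 0`, so such noise is
    -- admissible.
    have hpos : ∀ᵐ x ∂μ, 0 < pd x → 0 < pn x := by
      filter_upwards [hε] with x hx h
      refine (hpn.nonneg x).lt_of_ne' fun h0 => ?_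
      rw [hx.1, h0, mul_zero] at h
      exact lt_irrefl _ h
    have hpn' : Admissible pn := ⟨hpn, hpos.mono fun x hx h _ => hx h⟩
    have ht : ∀ᵐ x ∂P, |pd x / pn x - 1| ≤ δ := by
      refine (NCE.ae_withDensity_ofReal_iff hpd).2 ?_
      filter_upwards [hε, hpos] with x hx h h'
      rw [hx.1, mul_div_cancel_right₀ _ (h h').ne', add_sub_cancel_left]
      exact hx.2
    have hfin : D pn ≠ ⊤ := by
      refine (hD pn hpn').1.2 (Integrable.bdd_mul (c := 2) ?_ (htm pn hpn) ?_)
      · exact integrable_finsetSum _ fun i _ => (hGu i).integrable_mul (hGu i)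
      · filter_upwards [ht] with x hx
        rw [Real.norm_eq_abs, abs_le]
        have := abs_le.1 hx
        constructor <;> linarith
    refine ⟨hfin, ?_⟩
    rw [hmse pn hpn', (hD pn hpn').2 hfin, trace_sub]
    exact hC _ δ hδ (htm pn hpn) ht
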